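/- There are $m\ge 1$ disjoint communities $C_1,\dots,C_m$ with $|C_i|=d_i\ge 1$ members, and $\mu_i=1/d_i$. Every exploration of $C_i$ meets a uniformly random member of $C_i$, independently of everything else; $\Phi(i,\tau)$ denotes the member met in the $\tau$-th exploration of $C_i$ in a round. Each round has a budget of $K>m$ explorations. For an allocation $\boldsymbol k=(k_1,\dots,k_m)$ of non-negative integers let $R(\boldsymbol k,\Phi)=\sum_i|\{\Phi(i,1),\dots,\Phi(i,k_i)\}|$ and $r_{\boldsymbol k}(\boldsymbol\mu)=\mathbb E[R(\boldsymbol k,\Phi)]$, and let $\boldsymbol k^*$ maximize $r_{\boldsymbol k}(\boldsymbol\mu)$ over all $\boldsymbol k$ with $\sum_i k_i\le K$. The CLCB algorithm with non-adaptive exploration does not know the $d_i$. It starts with $T_i=X_i=0$ and $\hat\mu_i=0$ for all $i$. In round $t=1,2,\dots$ it sets $\rho_i=\sqrt{3\ln t/(2T_i)}$ ($\rho_i=0$ if $T_i=0$) and $\underline\mu_i=\max\{0,\hat\mu_i-\rho_i\}$, and computes an allocation $\boldsymbol k_t$ greedily: starting from $\boldsymbol k=0$, it $K$ times increases $k_{i}$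 by one for a uniformly random $i\in\arg\max_j(1-\underline\mu_j)^{k_j}$. It then explores each $C_i$ exactly $k_{i,t}$ times (with a fresh realization $\Phi_t$), adds $\lfloor k_{i,t}/2\rfloor$ to $T_i$, adds to $X_i$ the number of $x\in\{1,\dots,\lfloor k_{i,t}/2\rfloor\}$ for which the $(2x-1)$-st and the $2x$-th member met in $C_i$ in this round coincide, and sets $\hat\mu_i=X_i/T_i$ if $k_{i,t}>1$. Its regret is $$\mathrm{Reg}_{\boldsymbol\mu}(T)=\mathbb E\Big[\sum_{t=1}^T\big(R(\boldsymbol k^*,\Phi_t)-R(\boldsymbol k_t,\Phi_t)\big)\Big].$$ For $\boldsymbol k$ with $\sum_ik_i=K$ let $\Delta_{\boldsymbol k}=r_{\boldsymbol k^*}(\boldsymbol\mu)-r_{\boldsymbol k}(\boldsymbol\mu)$. Let $\Delta^i_{\min}$ and $\Delta^i_{\max}$ be the minimum and the maximum of $\Delta_{\boldsymbol k}$ over all such $\boldsymbol k$ with $\Delta_{\boldsymbol k}>0$ and $k_i>1$ ($\Delta^i_{\min}=\infty$ and $\Delta^i_{\max}=0$ if there are none), let $\Delta_{\max}=\max_i\Delta^i_{\max}$,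 and let $K'=K-m+1$. Theorem. For every $T\ge1$, $$\mathrm{Reg}_{\boldsymbol\mu}(T)\le\sum_{i=1}^m\frac{48\binom{K'}2K\ln T}{\Delta^i_{\min}}+2\binom{K'}2m+\frac{\lfloor K'/2\rfloor\pi^2}{3}\,m\,\Delta_{\max}.$$ Moreover $\mathrm{Reg}_{\boldsymbol\mu}(T)=O\big(\sum_{i=1}^mK'^3\log T/\Delta^i_{\min}\big)$ as $T\to\infty$ with an absolute implied constant: there is a constant $C>0$, independent of $m$, $K$ and $d_1,\dots,d_m$, such that for all $m,K,d_1,\dots,d_m$ as above one has $\mathrm{Reg}_{\boldsymbol\mu}(T)\le C\sum_{i=1}^mK'^3\ln T/\Delta^i_{\min}$ for all sufficiently large $T$ (how large may depend on $m,K,d_1,\dots,d_m$). -/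

import Mathlib

namespace CommunityExploration

/-! ### Exploration of communities

There are `m` disjoint communities; the `i`-th one has `d i` members, labelled by `Fin (d i)`.
In every round there is a budget of `K` explorations. -/

/-- A realization: `φ i τ` is the member of community `i` that is met in the `(τ + 1)`-st
exploration of that community. -/
abbrev Realization {m : ℕ} (d : Fin m → ℕ+) (K : ℕ) : Type :=
  (i : Fin m) → Fin K → Fin (d i : ℕ)

/-- The law of the random realization: all the entries `Φ i τ` are independent, and `Φ i τ` is
uniformly distributed on community `i`; that is, `Φ` is uniform on the product. -/
noncomputable def realizationLaw {m : ℕ} (d : Fin m → ℕ+) (K : ℕ) : PMF (Realization d K) :=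
  PMF.uniformOfFintype (Realization d K)

/-- The expectation of a real function under a discrete law. (All the laws below have finite
support, so that the sum has only finitely many nonzero terms.) -/
noncomputable def expectation {α : Type} (p : PMF α) (f : α → ℝ) : ℝ :=
  ∑' a, (p a).toReal * f a

/-- The reward `R(k, φ)`: the number of distinct members met when community `i` is explored
`k i` times. -/
def reward {m : ℕ} {d : Fin m → ℕ+} {K : ℕ} (k : Fin m → ℕ) (φ : Realization d K) : ℕ :=
  ∑ i, ((Finset.univ.filter fun τ : Fin K => (τ : ℕ) < k i).image (φ i)).card

/-- The expected reward `r_k(μ)` of the budget allocation `k`. -/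
noncomputable def expectedReward {m : ℕ} (d : Fin m → ℕ+) (K : ℕ) (k : Fin m → ℕ) : ℝ :=
  expectation (realizationLaw d K) fun φ => (reward k φ : ℝ)

/-- `k` maximizes the expected reward among all the allocations of a budget of at most `K`. -/
def IsOptimalAllocation {m : ℕ} (d : Fin m → ℕ+) (K : ℕ) (k : Fin m → ℕ) : Prop :=
  ∑ i, k i ≤ K ∧
    ∀ k' : Fin m → ℕ, ∑ i, k' i ≤ K → expectedReward d K k' ≤ expectedReward d K k

/-! ### The greedy budget allocation -/

open scoped Classical in
/-- The set of maximizers `i` of `(1 - μ i) ^ k i`. -/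
noncomputable def argmaxSet {m : ℕ} (μ : Fin m → ℝ) (k : Fin m → ℕ) : Finset (Fin m) :=
  Finset.univ.filter fun i => ∀ j, (1 - μ j) ^ k j ≤ (1 - μ i) ^ k i

theorem argmaxSet_nonempty {m : ℕ} [NeZero m] (μ : Fin m → ℝ) (k : Fin m → ℕ) :
    (argmaxSet μ k).Nonempty := by
  obtain ⟨i, hi⟩ := Finite.exists_max fun i => (1 - μ i) ^ k i
  exact ⟨i, by simpa [argmaxSet] using hi⟩

/-- The (random) allocation after `s` steps of the greedy method with parameters `μ`: starting
from `0`, each step adds one unit to a uniformly random maximizer of `(1 - μ i) ^ k i`. -/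
noncomputable def greedyAllocation {m : ℕ} [NeZero m] (μ : Fin m → ℝ) : ℕ → PMF (Fin m → ℕ)
  | 0 => PMF.pure fun _ => 0
  | s + 1 => (greedyAllocation μ s).bind fun k =>
      (PMF.uniformOfFinset (argmaxSet μ k) (argmaxSet_nonempty μ k)).map fun i =>
        Function.update k i (k i + 1)

/-! ### The CLCB algorithm with non-adaptive exploration -/

/-- What happened in the past rounds, the most recent round first: each entry is the
allocation that was played together with the realization of that round. -/
abbrev History {m : ℕ} (d : Fin m → ℕ+) (K : ℕ) : Type :=
  List ((Fin m → ℕ) × Realization d K)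

/-- The number of collisions among the disjoint pairs (1st, 2nd), (3rd, 4th), … of the
members `φ i 0, …, φ i (k i - 1)` of community `i` met in one round; there are `k i / 2` such
pairs (rounded down). -/
def collisions {m : ℕ} {d : Fin m → ℕ+} {K : ℕ} (k : Fin m → ℕ) (φ : Realization d K)
    (i : Fin m) : ℕ :=
  (Finset.univ.filter fun p : Fin K × Fin K =>
    Even (p.1 : ℕ) ∧ (p.2 : ℕ) = (p.1 : ℕ) + 1 ∧ (p.2 : ℕ) < k i ∧ φ i p.1 = φ i p.2).card

/-- `T_i`: the number of pairs of members of community `i` that were observed so far. -/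
def pairCount {m : ℕ} {d : Fin m → ℕ+} {K : ℕ} (h : History d K) (i : Fin m) : ℕ :=
  (h.map fun r => r.1 i / 2).sum

/-- `X_i`: the number of collisions in community `i` that were observed so far. -/
def collisionCount {m : ℕ} {d : Fin m → ℕ+} {K : ℕ} (h : History d K) (i : Fin m) : ℕ :=
  (h.map fun r => collisions r.1 r.2 i).sum

/-- The empirical mean `X_i / T_i`; it keeps its initial value `0` while `T_i = 0`. -/
noncomputable def empiricalMean {m : ℕ} {d : Fin m → ℕ+} {K : ℕ} (h : History d K)
    (i : Fin m) : ℝ :=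
  if pairCount h i = 0 then 0 else (collisionCount h i : ℝ) / (pairCount h i : ℝ)

/-- The confidence radius in round `t`, where `h` is the history before round `t`. -/
noncomputable def confidenceRadius {m : ℕ} {d : Fin m → ℕ+} {K : ℕ} (t : ℕ) (h : History d K)
    (i : Fin m) : ℝ :=
  if pairCount h i = 0 then 0 else Real.sqrt (3 * Real.log t / (2 * (pairCount h i : ℝ)))

/-- The lower confidence bound used in round `t`. -/
noncomputable def lowerConfidenceBound {m : ℕ} {d : Fin m → ℕ+} {K : ℕ} (t : ℕ)
    (h : History d K) (i : Fin m) : ℝ :=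
  max 0 (empiricalMean h i - confidenceRadius t h i)

/-- The law of the history after `t` rounds of the CLCB algorithm. In round `t + 1` the greedy
method distributes the budget `K` on the basis of the lower confidence bounds, and then an
independent realization is drawn. -/
noncomputable def clcbHistory {m : ℕ} [NeZero m] (d : Fin m → ℕ+) (K : ℕ) :
    ℕ → PMF (History d K)
  | 0 => PMF.pure []
  | t + 1 => (clcbHistory d K t).bind fun h =>
      (greedyAllocation (lowerConfidenceBound (t + 1) h) K).bind fun k =>
        (realizationLaw d K).map fun φ => (k, φ) :: h

/-- The `T`-round regret of the CLCB algorithm with respect to the allocation `kstar`: the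
expectation of the sum over the rounds `t = 1, …, T` of `R(kstar, Φ_t) - R(k_t, Φ_t)`. -/
noncomputable def regret {m : ℕ} [NeZero m] (d : Fin m → ℕ+) (K : ℕ) (kstar : Fin m → ℕ)
    (T : ℕ) : ℝ :=
  expectation (clcbHistory d K T) fun h =>
    (h.map fun r => (reward kstar r.2 : ℝ) - (reward r.1 r.2 : ℝ)).sum

/-! ### Gaps -/

/-- The gap `Δ_k = r_{kstar}(μ) - r_k(μ)` of the action `k`. -/
noncomputable def gap {m : ℕ} (d : Fin m → ℕ+) (K : ℕ) (kstar k : Fin m → ℕ) : ℝ :=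
  expectedReward d K kstar - expectedReward d K k

/-- The actions `k` (with `∑ k i = K`) with a positive gap that explore community `i` more than
once. -/
def badActions {m : ℕ} (d : Fin m → ℕ+) (K : ℕ) (kstar : Fin m → ℕ) (i : Fin m) :
    Set (Fin m → ℕ) :=
  {k | ∑ j, k j = K ∧ 0 < gap d K kstar k ∧ 1 < k i}

/-- `Δ^i_min`, the least gap of an action in `badActions`; it is `∞` if there is none. -/
noncomputable def gapMin {m : ℕ} (d : Fin m → ℕ+) (K : ℕ) (kstar : Fin m → ℕ) (i : Fin m) :
    ENNReal :=
  sInf ((fun k => ENNReal.ofReal (gap d K kstar k)) '' badActions d K kstar i)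

/-- `Δ^i_max`, the greatest gap of an action in `badActions` (a finite set); it is `0` if there
is none. -/
noncomputable def gapMaxAt {m : ℕ} (d : Fin m → ℕ+) (K : ℕ) (kstar : Fin m → ℕ) (i : Fin m) :
    ℝ :=
  sSup (gap d K kstar '' badActions d K kstar i)

/-- `Δ_max = max_i Δ^i_max`. -/
noncomputable def gapMax {m : ℕ} (d : Fin m → ℕ+) (K : ℕ) (kstar : Fin m → ℕ) : ℝ :=
  ⨆ i, gapMaxAt d K kstar i

/-- `1 / Δ^i_min` as a real number; it is `0` if `Δ^i_min = ∞`. -/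
noncomputable def invGapMin {m : ℕ} (d : Fin m → ℕ+) (K : ℕ) (kstar : Fin m → ℕ) (i : Fin m) :
    ℝ :=
  ((gapMin d K kstar i)⁻¹).toReal

end CommunityExploration

namespace CommunityExploration

section Expectation

variable {α β : Type}

theorem expectation_eq_sum {p : PMF α} {s : Finset α} (hs : p.support ⊆ s) (f : α → ℝ) :
    expectation p f = ∑ a ∈ s, (p a).toReal * f a := by
  unfold expectation
  refine tsum_eq_sum fun a ha => ?_
  have : p a = 0 := by
    by_contra h
    exact ha (hs ((PMF.mem_support_iff p a).2 h))
  simp [this]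

theorem sum_toReal_eq_one {p : PMF α} {s : Finset α} (hs : p.support ⊆ s) :
    ∑ a ∈ s, (p a).toReal = 1 := by
  rw [← ENNReal.toReal_sum fun a _ => p.apply_ne_top a, ← tsum_eq_sum (L := .unconditional _) (f := p),
    p.tsum_coe, ENNReal.toReal_one]
  intro a ha
  by_contra h
  exact ha (hs ((PMF.mem_support_iff p a).2 h))

theorem expectation_mono {p : PMF α} (hp : p.support.Finite) {f g : α → ℝ}
    (h : ∀ a ∈ p.support, f a ≤ g a) : expectation p f ≤ expectation p g := by
  have hs : p.support ⊆ hp.toFinset := by simp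
  rw [expectation_eq_sum hs, expectation_eq_sum hs]
  refine Finset.sum_le_sum fun a ha => ?_
  exact mul_le_mul_of_nonneg_left (h a (by simpa using ha)) ENNReal.toReal_nonneg

theorem expectation_congr {p : PMF α} (hp : p.support.Finite) {f g : α → ℝ}
    (h : ∀ a ∈ p.support, f a = g a) : expectation p f = expectation p g :=
  le_antisymm (expectation_mono hp fun a ha => (h a ha).le)
    (expectation_mono hp fun a ha => (h a ha).ge)

theorem expectation_add {p : PMF α} (hp : p.support.Finite) (f g : α → ℝ) :
    expectation p (fun a => f a + g a) = expectation p f + expectation p g := by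
  have hs : p.support ⊆ hp.toFinset := by simp
  rw [expectation_eq_sum hs, expectation_eq_sum hs, expectation_eq_sum hs,
    ← Finset.sum_add_distrib]
  exact Finset.sum_congr rfl fun a _ => mul_add _ _ _

theorem expectation_const_mul (p : PMF α) (c : ℝ) (f : α → ℝ) :
    expectation p (fun a => c * f a) = c * expectation p f := by
  unfold expectation
  rw [← tsum_mul_left]
  exact tsum_congr fun a => by ring

theorem expectation_mul_const (p : PMF α) (c : ℝ) (f : α → ℝ) :
    expectation p (fun a => f a * c) = expectation p f * c := by
  rw [mul_comm, ← expectation_const_mul]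
  simp_rw [mul_comm]

theorem expectation_sub {p : PMF α} (hp : p.support.Finite) (f g : α → ℝ) :
    expectation p (fun a => f a - g a) = expectation p f - expectation p g := by
  have := expectation_add hp f fun a => -1 * g a
  rw [expectation_const_mul] at this
  simpa [sub_eq_add_neg] using this

theorem expectation_sum {ι : Type} {p : PMF α} (hp : p.support.Finite) (s : Finset ι)
    (f : ι → α → ℝ) :
    expectation p (fun a => ∑ i ∈ s, f i a) = ∑ i ∈ s, expectation p (f i) := by
  have hs : p.support ⊆ hp.toFinset := by simp
  simp_rw [expectation_eq_sum hs, Finset.mul_sum]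
  exact Finset.sum_comm

theorem expectation_const {p : PMF α} (hp : p.support.Finite) (c : ℝ) :
    expectation p (fun _ => c) = c := by
  have hs : p.support ⊆ hp.toFinset := by simp
  rw [expectation_eq_sum hs, ← Finset.sum_mul, sum_toReal_eq_one hs, one_mul]

theorem expectation_pure (a : α) (f : α → ℝ) : expectation (PMF.pure a) f = f a := by
  rw [expectation_eq_sum (s := {a}) (by simp)]
  simp

theorem finite_support_bind {p : PMF α} (hp : p.support.Finite) {q : α → PMF β}
    (hq : ∀ a ∈ p.support, (q a).support.Finite) : (p.bind q).support.Finite := by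
  rw [PMF.support_bind]
  exact hp.biUnion hq

theorem finite_support_map {p : PMF α} (hp : p.support.Finite) (f : α → β) :
    (p.map f).support.Finite := by
  rw [PMF.support_map]
  exact hp.image f

theorem expectation_bind {p : PMF α} (hp : p.support.Finite) {q : α → PMF β}
    (hq : ∀ a ∈ p.support, (q a).support.Finite) (f : β → ℝ) :
    expectation (p.bind q) f = expectation p fun a => expectation (q a) f := by
  have hb := finite_support_bind hp hq
  have hs : p.support ⊆ hp.toFinset := by simp
  have hbs : (p.bind q).support ⊆ hb.toFinset := by simp
  rw [expectation_eq_sum hs, expectation_eq_sum hbs]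
  have h1 : ∀ b, ((p.bind q) b).toReal = ∑ a ∈ hp.toFinset, (p a).toReal * (q a b).toReal := by
    intro b
    rw [PMF.bind_apply, tsum_eq_sum (s := hp.toFinset), ENNReal.toReal_sum]
    · simp
    · intro a _
      exact ENNReal.mul_ne_top (p.apply_ne_top a) ((q a).apply_ne_top b)
    · intro a ha
      have : p a = 0 := by simpa using ha
      simp [this]
  simp_rw [h1, Finset.sum_mul]
  rw [Finset.sum_comm]
  refine Finset.sum_congr rfl fun a ha => ?_
  have ha' : a ∈ p.support := by simpa using ha
  have hqs : (q a).support ⊆ hb.toFinset := by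
    intro b hbq
    have : b ∈ (p.bind q).support := by
      rw [PMF.mem_support_bind_iff]
      exact ⟨a, ha', hbq⟩
    simpa using this
  rw [expectation_eq_sum hqs, Finset.mul_sum]
  exact Finset.sum_congr rfl fun b _ => by ring

theorem expectation_map {p : PMF α} (hp : p.support.Finite) (g : α → β) (f : β → ℝ) :
    expectation (p.map g) f = expectation p fun a => f (g a) := by
  rw [← PMF.bind_pure_comp, expectation_bind hp (fun a _ => by simp)]
  simp [expectation_pure]

theorem expectation_uniformOfFintype [Fintype α] [Nonempty α] (f : α → ℝ) :
    expectation (PMF.uniformOfFintype α) f = (∑ a, f a) / Fintype.card α := by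
  rw [expectation_eq_sum (s := Finset.univ) (by simp)]
  simp [div_eq_inv_mul, Finset.mul_sum]

end Expectation

section Greedy

/-- The expected number of distinct members met in `k` explorations of a community in which two
members coincide with probability `x`. -/
noncomputable def geomReward (x : ℝ) (k : ℕ) : ℝ := ∑ j ∈ Finset.range k, (1 - x) ^ j

/-- The local optimality condition that characterizes greedy allocations. -/
def IsGreedy {m : ℕ} (μ : Fin m → ℝ) (k : Fin m → ℕ) : Prop :=
  ∀ i j, 0 < k i → (1 - μ j) ^ k j ≤ (1 - μ i) ^ (k i - 1)

theorem finite_support_greedyAllocation {m : ℕ} [NeZero m] (μ : Fin m → ℝ) (s : ℕ) :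
    (greedyAllocation μ s).support.Finite := by
  induction s with
  | zero => simp [greedyAllocation]
  | succ s ih =>
    exact finite_support_bind ih fun k _ => finite_support_map (by simp) _

theorem greedyAllocation_support {m : ℕ} [NeZero m] {μ : Fin m → ℝ} (h0 : ∀ i, 0 ≤ μ i)
    (h1 : ∀ i, μ i ≤ 1) {s : ℕ} {k : Fin m → ℕ} (hk : k ∈ (greedyAllocation μ s).support) :
    ∑ i, k i = s ∧ IsGreedy μ k := by
  induction s generalizing k with
  | zero =>
    have : k = fun _ => 0 := by simpa [greedyAllocation] using hk
    subst this
    exact ⟨by simp, fun i j h => by simp at h⟩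
  | succ s ih =>
    rw [greedyAllocation, PMF.mem_support_bind_iff] at hk
    obtain ⟨k', hk', hk⟩ := hk
    rw [PMF.mem_support_map_iff] at hk
    obtain ⟨i, hi, rfl⟩ := hk
    rw [PMF.mem_support_uniformOfFinset_iff] at hi
    have hi' : ∀ j, (1 - μ j) ^ k' j ≤ (1 - μ i) ^ k' i := by simpa [argmaxSet] using hi
    obtain ⟨hs, hg⟩ := ih hk'
    have hmono : ∀ j, (1 - μ j) ^ (Function.update k' i (k' i + 1) j) ≤ (1 - μ j) ^ k' j := by
      intro j
      refine pow_le_pow_of_le_one (by linarith [h1 j]) (by linarith [h0 j]) ?_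
      by_cases hj : j = i
      · subst hj; simp
      · simp [hj]
    refine ⟨?_, fun a b ha => (hmono b).trans ?_⟩
    · rw [Finset.sum_update_of_mem (Finset.mem_univ i), ← hs,
        ← Finset.add_sum_erase _ _ (Finset.mem_univ i), Finset.sdiff_singleton_eq_erase]
      ring
    · by_cases hai : a = i
      · subst hai
        simpa using hi' b
      · simp only [Function.update_of_ne hai] at ha ⊢
        exact hg a b ha

theorem geomReward_sub_le {x v : ℝ} (h0 : 0 ≤ x) (h1 : x ≤ 1) {a b : ℕ}
    (hup : (1 - x) ^ a ≤ v) (hlo : 0 < a → v ≤ (1 - x) ^ (a - 1)) :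
    geomReward x b - geomReward x a ≤ v * ((b : ℝ) - a) := by
  unfold geomReward
  rcases le_total a b with hab | hab
  · rw [← Finset.sum_range_add_sum_Ico _ hab, add_sub_cancel_left]
    calc ∑ j ∈ Finset.Ico a b, (1 - x) ^ j ≤ ∑ j ∈ Finset.Ico a b, v := by
          refine Finset.sum_le_sum fun j hj => le_trans ?_ hup
          exact pow_le_pow_of_le_one (by linarith) (by linarith) (Finset.mem_Ico.1 hj).1
      _ = v * ((b : ℝ) - a) := by
          rw [Finset.sum_const, Nat.card_Ico, nsmul_eq_mul, Nat.cast_sub hab, mul_comm]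
  · rw [← Finset.sum_range_add_sum_Ico _ hab]
    have : v * ((a : ℝ) - b) ≤ ∑ j ∈ Finset.Ico b a, (1 - x) ^ j := by
      calc v * ((a : ℝ) - b) = ∑ j ∈ Finset.Ico b a, v := by
            rw [Finset.sum_const, Nat.card_Ico, nsmul_eq_mul, Nat.cast_sub hab, mul_comm]
        _ ≤ _ := by
          refine Finset.sum_le_sum fun j hj => ?_
          have := Finset.mem_Ico.1 hj
          refine (hlo (by omega)).trans ?_
          exact pow_le_pow_of_le_one (by linarith) (by linarith) (by omega)
    linarith

theorem IsGreedy.sum_geomReward_le {m : ℕ} [NeZero m] {μ : Fin m → ℝ} (h0 : ∀ i, 0 ≤ μ i)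
    (h1 : ∀ i, μ i ≤ 1) {k k' : Fin m → ℕ} (hk : IsGreedy μ k) (hle : ∑ i, k' i ≤ ∑ i, k i) :
    ∑ i, geomReward (μ i) (k' i) ≤ ∑ i, geomReward (μ i) (k i) := by
  obtain ⟨i₀, hi₀⟩ := Finite.exists_max fun i => (1 - μ i) ^ k i
  have hv : 0 ≤ (1 - μ i₀) ^ k i₀ := pow_nonneg (by linarith [h1 i₀]) _
  have key : ∑ i, (geomReward (μ i) (k' i) - geomReward (μ i) (k i)) ≤
      ∑ i, (1 - μ i₀) ^ k i₀ * ((k' i : ℝ) - k i) :=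
    Finset.sum_le_sum fun i _ => geomReward_sub_le (h0 i) (h1 i) (hi₀ i) fun h => hk i i₀ h
  rw [Finset.sum_sub_distrib, ← Finset.mul_sum, Finset.sum_sub_distrib] at key
  have : (∑ i, (k' i : ℝ)) ≤ ∑ i, (k i : ℝ) := by exact_mod_cast hle
  nlinarith

theorem IsGreedy.one_le {m : ℕ} {μ : Fin m → ℝ} (h0 : ∀ i, 0 < μ i)
    (h1 : ∀ i, μ i ≤ 1) {k : Fin m → ℕ} (hk : IsGreedy μ k) (hm : m ≤ ∑ i, k i) (i : Fin m) :
    1 ≤ k i := by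
  by_contra! hi
  have hi : k i = 0 := by omega
  have hle : ∀ j, k j ≤ 1 := by
    intro j
    by_contra! hj
    have h2 := hk j i (by omega)
    rw [hi, pow_zero] at h2
    have : (1 - μ j) ^ (k j - 1) < 1 :=
      pow_lt_one₀ (by linarith [h1 j]) (by linarith [h0 j]) (by omega)
    linarith
  have : ∑ j, k j < ∑ _j : Fin m, 1 :=
    Finset.sum_lt_sum (fun j _ => hle j) ⟨i, Finset.mem_univ i, by omega⟩
  simp at this
  omega

theorem IsGreedy.le_one_of_zero {m : ℕ} {μ : Fin m → ℝ} {k : Fin m → ℕ} (hk : IsGreedy μ k)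
    {i j : Fin m} (hi0 : 0 < μ i) (hi1 : μ i ≤ 1) (hj : μ j = 0) : k i ≤ 1 := by
  by_contra! h
  have h2 := hk i j (by omega)
  rw [hj, sub_zero, one_pow] at h2
  have : (1 - μ i) ^ (k i - 1) < 1 := pow_lt_one₀ (by linarith) (by linarith) (by omega)
  linarith

theorem IsGreedy.le_of_one_lt {m : ℕ} {μ : Fin m → ℝ} (h0 : ∀ i, 0 ≤ μ i) (h1 : ∀ i, μ i ≤ 1)
    {k : Fin m → ℕ} (hk : IsGreedy μ k) {i j : Fin m} (hi : k i = 1) (hj : 1 < k j) :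
    μ j ≤ μ i := by
  have h2 := hk j i (by omega)
  rw [hi, pow_one] at h2
  have : (1 - μ j) ^ (k j - 1) ≤ (1 - μ j) ^ 1 :=
    pow_le_pow_of_le_one (by linarith [h1 j]) (by linarith [h0 j]) (by omega)
  rw [pow_one] at this
  linarith

theorem exists_one_lt {m : ℕ} {k : Fin m → ℕ} (h : m < ∑ i, k i) : ∃ i, 1 < k i := by
  by_contra! hle
  have : ∑ j, k j ≤ ∑ _j : Fin m, 1 := Finset.sum_le_sum fun j _ => hle j
  simp at this
  omega

theorem geomReward_anti {x y : ℝ} (hxy : x ≤ y) (hy : y ≤ 1) (k : ℕ) :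
    geomReward y k ≤ geomReward x k :=
  Finset.sum_le_sum fun j _ => pow_le_pow_left₀ (by linarith) (by linarith) j

theorem geomReward_sub_geomReward_le {x y : ℝ} (hx : 0 ≤ x) (hxy : x ≤ y) (hy : y ≤ 1) (k : ℕ) :
    geomReward x k - geomReward y k ≤ (k : ℝ) * (k - 1) / 2 * (y - x) := by
  have hstep : ∀ j : ℕ, (1 - x) ^ j - (1 - y) ^ j ≤ j * (y - x) := by
    intro j
    induction j with
    | zero => simp
    | succ j ih =>
      have h1 : (1 - x) ^ j ≤ 1 := pow_le_one₀ (by linarith) (by linarith)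
      have h3 : (1 - x) ^ (j + 1) - (1 - y) ^ (j + 1)
          = (1 - x) ^ j * (y - x) + ((1 - x) ^ j - (1 - y) ^ j) * (1 - y) := by ring
      have h4 : ((1 - x) ^ j - (1 - y) ^ j) * (1 - y) ≤ j * (y - x) := by
        have : 0 ≤ (1 - x) ^ j - (1 - y) ^ j :=
          sub_nonneg.2 (pow_le_pow_left₀ (by linarith) (by linarith) j)
        nlinarith
      rw [h3]
      push_cast
      nlinarith
  induction k with
  | zero => simp [geomReward]
  | succ k ih =>
    unfold geomReward at ih ⊢
    rw [Finset.sum_range_succ, Finset.sum_range_succ]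
    push_cast
    have := hstep k
    nlinarith

theorem geomReward_le {x : ℝ} (h0 : 0 ≤ x) (h1 : x ≤ 1) (k : ℕ) : geomReward x k ≤ k := by
  unfold geomReward
  calc _ ≤ ∑ _j ∈ Finset.range k, (1 : ℝ) :=
        Finset.sum_le_sum fun j _ => pow_le_one₀ (by linarith) (by linarith)
    _ = k := by simp

theorem geomReward_nonneg {x : ℝ} (h1 : x ≤ 1) (k : ℕ) : 0 ≤ geomReward x k :=
  Finset.sum_nonneg fun j _ => pow_nonneg (by linarith) j

end Greedy

section Realization

theorem sum_pi_eval {m : ℕ} {β : Fin m → Type} [∀ i, Fintype (β i)] [∀ i, Nonempty (β i)]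
    (i : Fin m) (G : β i → ℝ) :
    (∑ φ : (∀ j, β j), G (φ i)) / Fintype.card (∀ j, β j)
      = (∑ b, G b) / Fintype.card (β i) := by
  classical
  have h1 : ∑ φ : (∀ j, β j), G (φ i) =
      Fintype.card (∀ j : {j // j ≠ i}, β j) * ∑ b, G b := by
    rw [← Equiv.sum_comp (Equiv.piSplitAt i β).symm, Fintype.sum_prod_type]
    simp [Equiv.piSplitAt, Finset.mul_sum]
  have h2 : Fintype.card (∀ j, β j) =
      Fintype.card (β i) * Fintype.card (∀ j : {j // j ≠ i}, β j) := by
    rw [Fintype.card_congr (Equiv.piSplitAt i β), Fintype.card_prod]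
  have h3 : (Fintype.card (∀ j : {j // j ≠ i}, β j) : ℝ) ≠ 0 := by
    exact_mod_cast Fintype.card_ne_zero
  have h4 : (Fintype.card (β i) : ℝ) ≠ 0 := by exact_mod_cast Fintype.card_ne_zero
  rw [h1, h2]
  push_cast
  field_simp

theorem expectation_realizationLaw_eval {m : ℕ} (d : Fin m → ℕ+) (K : ℕ) (i : Fin m)
    (G : (Fin K → Fin (d i : ℕ)) → ℝ) :
    expectation (realizationLaw d K) (fun φ => G (φ i)) =
      (∑ ψ, G ψ) / ((d i : ℕ) : ℝ) ^ K := by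
  unfold realizationLaw
  rw [expectation_uniformOfFintype]
  have := sum_pi_eval (β := fun i => Fin K → Fin (d i : ℕ)) i G
  rw [this]
  simp

theorem sum_prod_eval_div {n K : ℕ} (F : Fin K → Fin n → ℝ) :
    (∑ ψ : Fin K → Fin n, ∏ τ, F τ (ψ τ)) / (n : ℝ) ^ K = ∏ τ, ((∑ b, F τ b) / n) := by
  rw [Finset.prod_div_distrib, Finset.prod_univ_sum, Fintype.piFinset_univ]
  simp

theorem prod_fin_ite_lt {k K : ℕ} (hk : k ≤ K) (g : ℕ → ℝ) :
    ∏ τ : Fin K, (if (τ : ℕ) < k then g τ else 1) = ∏ τ ∈ Finset.range k, g τ := by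
  rw [Fin.prod_univ_eq_prod_range (fun τ => if τ < k then g τ else 1) K, Finset.prod_ite,
    Finset.prod_const_one, mul_one]
  congr 1
  ext τ
  simp
  omega

theorem prod_range_odd (c : ℝ) (k : ℕ) :
    ∏ τ ∈ Finset.range k, (if Odd τ then c else 1) = c ^ (k / 2) := by
  induction k with
  | zero => simp
  | succ k ih =>
    rw [Finset.prod_range_succ, ih]
    by_cases h : Odd k
    · rw [if_pos h, ← pow_succ]
      obtain ⟨j, rfl⟩ := h
      congr 1
      omega
    · rw [if_neg h, mul_one]
      rw [Nat.not_odd_iff_even] at h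
      obtain ⟨j, rfl⟩ := h
      congr 1
      omega

theorem sum_card_image_div {n K k : ℕ} (hn : 0 < n) (hk : k ≤ K) :
    (∑ ψ : Fin K → Fin n,
        (((Finset.univ.filter fun τ : Fin K => (τ : ℕ) < k).image ψ).card : ℝ)) / (n : ℝ) ^ K
      = geomReward (1 / n) k := by
  have hn' : (n : ℝ) ≠ 0 := by positivity
  have h1 : ∀ ψ : Fin K → Fin n,
      (((Finset.univ.filter fun τ : Fin K => (τ : ℕ) < k).image ψ).card : ℝ) =
        ∑ x : Fin n, (1 - ∏ τ : Fin K, (if (τ : ℕ) < k then (if ψ τ = x then (0 : ℝ) else 1)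
          else 1)) := by
    intro ψ
    rw [Finset.card_eq_sum_ones, Nat.cast_sum, ← Finset.sum_subset (Finset.subset_univ _)]
    · refine Finset.sum_congr rfl fun x hx => ?_
      obtain ⟨τ, hτ, rfl⟩ := Finset.mem_image.1 hx
      rw [Finset.prod_eq_zero (Finset.mem_univ τ)]
      · simp
      · simpa using hτ
    · intro x _ hx
      rw [Finset.prod_eq_one, sub_self]
      intro τ _
      split_ifs with h2 h3
      · exact absurd (Finset.mem_image.2 ⟨τ, by simpa using h2, h3⟩) hx
      · rfl
      · rfl
  have h2 : ∀ x : Fin n, (∑ ψ : Fin K → Fin n, ∏ τ : Fin K,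
      (if (τ : ℕ) < k then (if ψ τ = x then (0 : ℝ) else 1) else 1)) / (n : ℝ) ^ K
      = (1 - 1 / n) ^ k := by
    intro x
    rw [sum_prod_eval_div fun τ b => if (τ : ℕ) < k then (if b = x then (0 : ℝ) else 1) else 1]
    have : ∀ τ : Fin K, (∑ b : Fin n, (if (τ : ℕ) < k then (if b = x then (0 : ℝ) else 1)
        else 1)) / n = if (τ : ℕ) < k then 1 - 1 / (n : ℝ) else 1 := by
      intro τ
      split_ifs
      · have : ∀ b : Fin n, (if b = x then (0 : ℝ) else 1) = 1 - if b = x then 1 else 0 := by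
          intro b; split_ifs <;> simp
        simp_rw [this, Finset.sum_sub_distrib]
        simp
        field_simp
      · simp [hn']
    simp_rw [this]
    rw [prod_fin_ite_lt hk fun _ => 1 - 1 / (n : ℝ)]
    simp
  simp_rw [h1]
  rw [Finset.sum_comm, Finset.sum_div]
  have h3 : ∀ x : Fin n, (∑ ψ : Fin K → Fin n, (1 - ∏ τ : Fin K,
      (if (τ : ℕ) < k then (if ψ τ = x then (0 : ℝ) else 1) else 1))) / (n : ℝ) ^ K
      = 1 - (1 - 1 / n) ^ k := by
    intro x
    rw [Finset.sum_sub_distrib, sub_div, h2]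
    simp [hn']
  simp_rw [h3]
  have h4 := geom_sum_mul (1 - 1 / (n : ℝ)) k
  unfold geomReward
  simp only [Finset.sum_const, Finset.card_univ, Fintype.card_fin, nsmul_eq_mul]
  have h5 : 1 - (1 - 1 / (n : ℝ)) ^ k
      = (∑ i ∈ Finset.range k, (1 - 1 / (n : ℝ)) ^ i) * (1 / n) := by linarith
  rw [h5]
  field_simp

/-- The probability that two random members of the community coincide. -/
noncomputable def collisionProb {m : ℕ} (d : Fin m → ℕ+) (i : Fin m) : ℝ := 1 / ((d i : ℕ) : ℝ)

theorem finite_support_realizationLaw {m : ℕ} (d : Fin m → ℕ+) (K : ℕ) :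
    (realizationLaw d K).support.Finite := Set.toFinite _

theorem expectedReward_eq {m : ℕ} (d : Fin m → ℕ+) {K : ℕ} {k : Fin m → ℕ} (hk : ∀ i, k i ≤ K) :
    expectedReward d K k = ∑ i, geomReward (collisionProb d i) (k i) := by
  unfold expectedReward reward
  push_cast
  rw [expectation_sum (finite_support_realizationLaw d K)]
  refine Finset.sum_congr rfl fun i _ => ?_
  rw [expectation_realizationLaw_eval d K i
    fun ψ => (((Finset.univ.filter fun τ : Fin K => (τ : ℕ) < k i).image ψ).card : ℝ)]
  exact sum_card_image_div (d i).pos (hk i)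

theorem expectedReward_eq_of_sum_le {m : ℕ} (d : Fin m → ℕ+) {K : ℕ} {k : Fin m → ℕ}
    (hk : ∑ i, k i ≤ K) :
    expectedReward d K k = ∑ i, geomReward (collisionProb d i) (k i) :=
  expectedReward_eq d fun i =>
    (Finset.single_le_sum (fun j _ => Nat.zero_le (k j)) (Finset.mem_univ i)).trans hk

theorem collisionProb_pos {m : ℕ} (d : Fin m → ℕ+) (i : Fin m) : 0 < collisionProb d i := by
  have := (d i).pos
  unfold collisionProb
  positivity

theorem collisionProb_le_one {m : ℕ} (d : Fin m → ℕ+) (i : Fin m) : collisionProb d i ≤ 1 := by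
  have : (1 : ℝ) ≤ ((d i : ℕ) : ℝ) := by exact_mod_cast (d i).pos
  unfold collisionProb
  rw [div_le_one (by linarith)]
  exact this

end Realization

section Collisions

/-- The predecessor of an index; `0` is sent to itself. -/
def prevIndex {K : ℕ} (τ : Fin K) : Fin K := ⟨τ - 1, by omega⟩

/-- The change of variables that replaces the second member of each pair by its difference to
the first one. -/
def pairDifference (n K : ℕ) [NeZero n] : (Fin K → Fin n) ≃ (Fin K → Fin n) where
  toFun φ τ := if Odd (τ : ℕ) then φ τ - φ (prevIndex τ) else φ τ
  invFun ψ τ := if Odd (τ : ℕ) then ψ τ + ψ (prevIndex τ) else ψ τ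
  left_inv φ := by
    ext1 τ
    by_cases h : Odd (τ : ℕ)
    · have h' : ¬ Odd (prevIndex τ : ℕ) := by
        simp only [prevIndex, Nat.not_odd_iff_even]
        obtain ⟨j, hj⟩ := h
        exact ⟨j, by omega⟩
      simp [h, h']
    · simp [h]
  right_inv ψ := by
    ext1 τ
    by_cases h : Odd (τ : ℕ)
    · have h' : ¬ Odd (prevIndex τ : ℕ) := by
        simp only [prevIndex, Nat.not_odd_iff_even]
        obtain ⟨j, hj⟩ := h
        exact ⟨j, by omega⟩
      simp [h, h']
    · simp [h]

theorem collisions_eq {m : ℕ} {d : Fin m → ℕ+} {K : ℕ} (k : Fin m → ℕ) (φ : Realization d K)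
    (i : Fin m) :
    collisions k φ i = (Finset.univ.filter fun τ : Fin K =>
      (τ : ℕ) < k i ∧ Odd (τ : ℕ) ∧ φ i (prevIndex τ) = φ i τ).card := by
  unfold collisions
  refine Finset.card_nbij' (fun p => p.2) (fun τ => (prevIndex τ, τ)) ?_ ?_ ?_ ?_
  · rintro ⟨a, b⟩ h
    simp only [Finset.coe_filter, Finset.mem_univ, true_and, Set.mem_ofPred_eq] at h ⊢
    obtain ⟨h1, h2, h3, h4⟩ := h
    have : prevIndex b = a := Fin.ext (by simp [prevIndex, h2])
    exact ⟨h3, h2 ▸ h1.add_one, by rw [this, h4]⟩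
  · intro τ h
    simp only [Finset.coe_filter, Finset.mem_univ, true_and, Set.mem_ofPred_eq] at h ⊢
    obtain ⟨h1, ⟨j, hj⟩, h3⟩ := h
    refine ⟨⟨j, ?_⟩, ?_, h1, h3⟩ <;> simp [prevIndex] <;> omega
  · rintro ⟨a, b⟩ h
    simp only [Finset.coe_filter, Finset.mem_univ, true_and, Set.mem_ofPred_eq] at h ⊢
    exact Prod.ext (Fin.ext (by simp [prevIndex, h.2.1])) rfl
  · intro τ _
    rfl

theorem expectation_exp_collisions {m : ℕ} (d : Fin m → ℕ+) {K : ℕ} {k : Fin m → ℕ} (i : Fin m)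
    (hk : k i ≤ K) (l : ℝ) :
    expectation (realizationLaw d K) (fun φ => Real.exp (l * collisions k φ i)) =
      (1 - collisionProb d i + collisionProb d i * Real.exp l) ^ (k i / 2) := by
  have hn : NeZero (d i : ℕ) := ⟨(d i).pos.ne'⟩
  have hn' : ((d i : ℕ) : ℝ) ≠ 0 := by exact_mod_cast hn.out
  have h1 : ∀ φ : Realization d K, Real.exp (l * collisions k φ i) =
      ∏ τ : Fin K, (if (τ : ℕ) < k i then (if Odd (τ : ℕ) then
        (if pairDifference (d i : ℕ) K (φ i) τ = 0 then Real.exp l else 1) else 1) else 1) := by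
    intro φ
    rw [collisions_eq, mul_comm, Real.exp_nat_mul, ← Finset.prod_const, Finset.prod_filter]
    refine Finset.prod_congr rfl fun τ _ => ?_
    by_cases h1 : (τ : ℕ) < k i <;> by_cases h2 : Odd (τ : ℕ) <;>
      simp [h1, h2, pairDifference, sub_eq_zero, eq_comm]
  simp_rw [h1]
  rw [expectation_realizationLaw_eval d K i fun ψ => ∏ τ : Fin K, (if (τ : ℕ) < k i then
      (if Odd (τ : ℕ) then
        (if pairDifference (d i : ℕ) K ψ τ = 0 then Real.exp l else 1) else 1) else 1),
    Equiv.sum_comp (pairDifference (d i : ℕ) K) fun ψ => ∏ τ : Fin K, (if (τ : ℕ) < k i then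
      (if Odd (τ : ℕ) then (if ψ τ = 0 then Real.exp l else 1) else 1) else 1),
    sum_prod_eval_div fun τ b => (if (τ : ℕ) < k i then
      (if Odd (τ : ℕ) then (if b = 0 then Real.exp l else 1) else 1) else 1)]
  rw [← prod_range_odd, ← prod_fin_ite_lt hk]
  refine Finset.prod_congr rfl fun τ _ => ?_
  by_cases h1 : (τ : ℕ) < k i <;> by_cases h2 : Odd (τ : ℕ) <;> simp only [h1, h2, if_true, if_false]
  · have : ∀ b : Fin (d i : ℕ), (if b = 0 then Real.exp l else 1)
        = 1 + if b = 0 then Real.exp l - 1 else 0 := by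
      intro b; split_ifs <;> simp
    simp_rw [this, Finset.sum_add_distrib]
    simp [collisionProb]
    field_simp
    ring
  all_goals simp [hn']

end Collisions

section HistoryLaw

theorem bernoulli_mgf_le {p : ℝ} (h0 : 0 ≤ p) (h1 : p ≤ 1) (l : ℝ) :
    1 - p + p * Real.exp l ≤ Real.exp (l * p + l ^ 2 / 8) := by
  open MeasureTheory in
  let ν : Measure ℝ :=
    ENNReal.ofReal (1 - p) • Measure.dirac (-p) + ENNReal.ofReal p • Measure.dirac (1 - p)
  have hint : ∀ f : ℝ → ℝ, ∫ x, f x ∂ν = (1 - p) * f (-p) + p * f (1 - p) := by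
    intro f
    have hi : ∀ (c a : ℝ), Integrable f (ENNReal.ofReal c • Measure.dirac a) := fun c a =>
      (integrable_dirac (by finiteness)).smul_measure ENNReal.ofReal_ne_top
    rw [integral_add_measure (hi _ _) (hi _ _), integral_smul_measure, integral_smul_measure,
      integral_dirac, integral_dirac, ENNReal.toReal_ofReal (by linarith),
      ENNReal.toReal_ofReal h0, smul_eq_mul, smul_eq_mul]
  have hprob : IsProbabilityMeasure ν := ⟨by
    simp only [ν, Measure.add_apply, Measure.smul_apply, measure_univ, smul_eq_mul, mul_one]
    rw [← ENNReal.ofReal_add (by linarith) h0]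
    simp⟩
  have hb : ∀ᵐ x ∂ν, (id x : ℝ) ∈ Set.Icc (-p) (1 - p) := by
    simp only [ν, ae_add_measure_iff]
    constructor <;> refine Measure.ae_smul_measure ?_ _ <;> rw [ae_dirac_eq] <;>
      simp
  have hs := ProbabilityTheory.hasSubgaussianMGF_of_mem_Icc_of_integral_eq_zero
    (μ := ν) (X := id) aemeasurable_id hb (by rw [hint]; simp; ring)
  have h2 := hs.mgf_le l
  unfold ProbabilityTheory.mgf at h2
  rw [hint] at h2
  have h3 : Real.exp (l * p) * ((1 - p) * Real.exp (l * id (-p)) + p * Real.exp (l * id (1 - p)))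
      = 1 - p + p * Real.exp l := by
    have e1 : Real.exp (l * p) * Real.exp (l * id (-p)) = 1 := by
      rw [← Real.exp_add]; simp
    have e2 : Real.exp (l * p) * Real.exp (l * id (1 - p)) = Real.exp l := by
      rw [← Real.exp_add]; congr 1; simp; ring
    linear_combination (1 - p) * e1 + p * e2
  rw [← h3, Real.exp_add]
  refine mul_le_mul_of_nonneg_left (h2.trans (le_of_eq ?_)) (Real.exp_pos _).le
  congr 1
  simp
  ring

variable {m : ℕ} {d : Fin m → ℕ+} {K : ℕ}

theorem pairCount_cons (k : Fin m → ℕ) (φ : Realization d K) (h : History d K) (i : Fin m) :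
    pairCount ((k, φ) :: h) i = k i / 2 + pairCount h i := by
  simp [pairCount]

theorem collisionCount_cons (k : Fin m → ℕ) (φ : Realization d K) (h : History d K) (i : Fin m) :
    collisionCount ((k, φ) :: h) i = collisions k φ i + collisionCount h i := by
  simp [collisionCount]

/-- The exponential supermartingale of the numbers of collisions in community `i`. -/
noncomputable def expProcess (d : Fin m → ℕ+) (K : ℕ) (i : Fin m) (l : ℝ) (h : History d K) : ℝ :=
  Real.exp (l * (collisionCount h i - collisionProb d i * pairCount h i)
    - l ^ 2 * pairCount h i / 8)

theorem expectation_expProcess_cons_le (i : Fin m) (l : ℝ) (h : History d K) {k : Fin m → ℕ}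
    (hk : k i ≤ K) :
    expectation (realizationLaw d K) (fun φ => expProcess d K i l ((k, φ) :: h))
      ≤ expProcess d K i l h := by
  have h1 : ∀ φ : Realization d K, expProcess d K i l ((k, φ) :: h) =
      (expProcess d K i l h * Real.exp (-(l * collisionProb d i + l ^ 2 / 8) * (k i / 2 : ℕ)))
        * Real.exp (l * collisions k φ i) := by
    intro φ
    unfold expProcess
    rw [pairCount_cons, collisionCount_cons, ← Real.exp_add, ← Real.exp_add]
    congr 1
    push_cast
    ring
  simp_rw [h1]
  rw [expectation_const_mul, expectation_exp_collisions d i hk, mul_assoc]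
  refine mul_le_of_le_one_right (Real.exp_pos _).le ?_
  have hp0 := (collisionProb_pos d i).le
  have hp1 := collisionProb_le_one d i
  calc _ ≤ Real.exp (-(l * collisionProb d i + l ^ 2 / 8) * (k i / 2 : ℕ))
        * Real.exp (l * collisionProb d i + l ^ 2 / 8) ^ (k i / 2) := by
        refine mul_le_mul_of_nonneg_left (pow_le_pow_left₀ ?_ (bernoulli_mgf_le hp0 hp1 l) _)
          (Real.exp_pos _).le
        have := mul_nonneg hp0 (Real.exp_pos l).le
        linarith
    _ = 1 := by
        rw [← Real.exp_nat_mul, ← Real.exp_add, Real.exp_eq_one_iff]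
        ring

theorem collisionCount_nil (i : Fin m) : collisionCount ([] : History d K) i = 0 := by
  simp [collisionCount]

theorem pairCount_nil (i : Fin m) : pairCount ([] : History d K) i = 0 := by
  simp [pairCount]

theorem card_pairs_le (k : ℕ) (K : ℕ) :
    (Finset.univ.filter fun τ : Fin K => (τ : ℕ) < k ∧ Odd (τ : ℕ)).card ≤ k / 2 := by
  have : k / 2 = (Finset.range (k / 2)).card := by simp
  rw [this]
  refine Finset.card_le_card_of_injOn (fun τ : Fin K => (τ : ℕ) / 2) ?_ ?_
  · intro τ hτ
    simp only [Finset.coe_filter, Finset.mem_univ, true_and, Set.mem_ofPred_eq] at hτ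
    obtain ⟨h1, j, hj⟩ := hτ
    simp only [Finset.coe_range, Set.mem_Iio]
    omega
  · intro a ha b hb hab
    simp only [Finset.coe_filter, Finset.mem_univ, true_and, Set.mem_ofPred_eq] at ha hb hab
    obtain ⟨-, j, hj⟩ := ha
    obtain ⟨-, j', hj'⟩ := hb
    exact Fin.ext (by omega)

theorem collisions_le (k : Fin m → ℕ) (φ : Realization d K) (i : Fin m) :
    collisions k φ i ≤ k i / 2 := by
  rw [collisions_eq]
  refine (Finset.card_le_card ?_).trans (card_pairs_le (k i) K)
  intro τ
  simp only [Finset.mem_filter, Finset.mem_univ, true_and]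
  tauto

theorem collisionCount_le (h : History d K) (i : Fin m) : collisionCount h i ≤ pairCount h i := by
  induction h with
  | nil => simp [collisionCount_nil]
  | cons r h ih =>
    obtain ⟨k, φ⟩ := r
    rw [pairCount_cons, collisionCount_cons]
    exact add_le_add (collisions_le k φ i) ih

theorem empiricalMean_le_one (h : History d K) (i : Fin m) : empiricalMean h i ≤ 1 := by
  unfold empiricalMean
  split_ifs
  · norm_num
  · exact div_le_one_of_le₀ (by exact_mod_cast collisionCount_le h i) (Nat.cast_nonneg _)

theorem confidenceRadius_nonneg (t : ℕ) (h : History d K) (i : Fin m) :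
    0 ≤ confidenceRadius t h i := by
  unfold confidenceRadius
  split_ifs
  · exact le_rfl
  · exact Real.sqrt_nonneg _

theorem lowerConfidenceBound_nonneg (t : ℕ) (h : History d K) (i : Fin m) :
    0 ≤ lowerConfidenceBound t h i := le_max_left _ _

theorem lowerConfidenceBound_le_one (t : ℕ) (h : History d K) (i : Fin m) :
    lowerConfidenceBound t h i ≤ 1 :=
  max_le (by norm_num) (by linarith [empiricalMean_le_one h i, confidenceRadius_nonneg t h i])

theorem le_of_sum_eq {k : Fin m → ℕ} (h : ∑ i, k i = K) (i : Fin m) : k i ≤ K :=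
  h ▸ Finset.single_le_sum (fun j _ => Nat.zero_le (k j)) (Finset.mem_univ i)

open Classical in
/-- The indicator of a proposition. -/
noncomputable def ind (p : Prop) : ℝ := if p then 1 else 0

theorem ind_of_true {p : Prop} (h : p) : ind p = 1 := if_pos h

theorem ind_of_false {p : Prop} (h : ¬ p) : ind p = 0 := if_neg h

theorem ind_nonneg (p : Prop) : 0 ≤ ind p := by
  unfold ind; split_ifs <;> norm_num

theorem ind_le_one (p : Prop) : ind p ≤ 1 := by
  unfold ind; split_ifs <;> norm_num

theorem ind_le_of_imp {p : Prop} {x : ℝ} (h0 : 0 ≤ x) (h : p → 1 ≤ x) : ind p ≤ x := by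
  by_cases hp : p
  · rw [ind_of_true hp]; exact h hp
  · rw [ind_of_false hp]; exact h0

open Classical in
/-- The process `F`, stopped when it reaches the level `a`. -/
noncomputable def stopAt (a : ℝ) (F : History d K → ℝ) : History d K → ℝ
  | [] => F []
  | r :: h => if a ≤ stopAt a F h then stopAt a F h else F (r :: h)

theorem stopAt_eq_of_lt {a : ℝ} {F : History d K → ℝ} {h : History d K}
    (hlt : ¬ a ≤ stopAt a F h) : stopAt a F h = F h := by
  cases h with
  | nil => rfl
  | cons r h =>
    rw [stopAt] at hlt ⊢
    split_ifs at hlt ⊢ with h1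
    · exact absurd h1 hlt
    · rfl

theorem le_stopAt {a : ℝ} {F : History d K → ℝ} {h h' : History d K} (hs : h' <:+ h)
    (ha : a ≤ F h') : a ≤ stopAt a F h := by
  induction h with
  | nil =>
    rw [List.suffix_nil.1 hs] at ha
    exact ha
  | cons r h ih =>
    rw [stopAt]
    split_ifs with h1
    · exact h1
    · rcases List.suffix_cons_iff.1 hs with rfl | h2
      · exact ha
      · exact absurd (ih h2) h1

/-- The histories that the algorithm can produce. -/
def IsReachable [NeZero m] : History d K → Prop
  | [] => True
  | r :: h => r.1 ∈ (greedyAllocation (lowerConfidenceBound (h.length + 1) h) K).support ∧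
      IsReachable h

variable [NeZero m]

theorem clcbHistory_support {T : ℕ} {h : History d K} (hh : h ∈ (clcbHistory d K T).support) :
    h.length = T ∧ IsReachable h := by
  induction T generalizing h with
  | zero =>
    have : h = [] := by simpa [clcbHistory] using hh
    subst this
    exact ⟨rfl, trivial⟩
  | succ T ih =>
    rw [clcbHistory, PMF.mem_support_bind_iff] at hh
    obtain ⟨h', hh', hh⟩ := hh
    rw [PMF.mem_support_bind_iff] at hh
    obtain ⟨k, hk, hh⟩ := hh
    rw [PMF.mem_support_map_iff] at hh
    obtain ⟨φ, -, rfl⟩ := hh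
    obtain ⟨hl, hr⟩ := ih hh'
    refine ⟨by simp [hl], ?_, hr⟩
    rw [hl]
    exact hk

theorem finite_support_clcbHistory (d : Fin m → ℕ+) (K T : ℕ) :
    (clcbHistory d K T).support.Finite := by
  induction T with
  | zero => simp [clcbHistory]
  | succ T ih =>
    exact finite_support_bind ih fun h _ =>
      finite_support_bind (finite_support_greedyAllocation _ K) fun k _ =>
        finite_support_map (finite_support_realizationLaw d K) _

theorem expectation_clcbHistory_succ (d : Fin m → ℕ+) (K T : ℕ) (F : History d K → ℝ) :
    expectation (clcbHistory d K (T + 1)) F = expectation (clcbHistory d K T) fun h =>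
      expectation (greedyAllocation (lowerConfidenceBound (T + 1) h) K) fun k =>
        expectation (realizationLaw d K) fun φ => F ((k, φ) :: h) := by
  have hr := finite_support_realizationLaw d K
  have hg : ∀ h : History d K,
    (greedyAllocation (lowerConfidenceBound (T + 1) h) K).support.Finite :=
    fun h => finite_support_greedyAllocation _ K
  rw [clcbHistory, expectation_bind (finite_support_clcbHistory d K T)
    fun h _ => finite_support_bind (hg h) fun k _ => finite_support_map hr _]
  refine congrArg _ (funext fun h => ?_)
  rw [expectation_bind (hg h) fun k _ => finite_support_map hr _]
  refine congrArg _ (funext fun k => ?_)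
  rw [expectation_map hr]

theorem expectation_clcbHistory_zero (d : Fin m → ℕ+) (K : ℕ) (F : History d K → ℝ) :
    expectation (clcbHistory d K 0) F = F [] := by
  rw [clcbHistory, expectation_pure]

theorem greedy_lowerConfidenceBound {t : ℕ} {h : History d K} {k : Fin m → ℕ}
    (hk : k ∈ (greedyAllocation (lowerConfidenceBound t h) K).support) :
    ∑ i, k i = K ∧ IsGreedy (lowerConfidenceBound t h) k :=
  greedyAllocation_support (lowerConfidenceBound_nonneg t h) (lowerConfidenceBound_le_one t h) hk

/-- If one round of the algorithm does not increase `F` in expectation, then `F` is a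
supermartingale. -/
theorem expectation_clcbHistory_le (F : History d K → ℝ)
    (hF : ∀ (h : History d K) (k : Fin m → ℕ), ∑ i, k i = K →
      expectation (realizationLaw d K) (fun φ => F ((k, φ) :: h)) ≤ F h) (T : ℕ) :
    expectation (clcbHistory d K T) F ≤ F [] := by
  induction T with
  | zero => rw [expectation_clcbHistory_zero]
  | succ T ih =>
    rw [expectation_clcbHistory_succ]
    refine (expectation_mono (finite_support_clcbHistory d K T) fun h _ => ?_).trans ih
    have hg := finite_support_greedyAllocation (lowerConfidenceBound (T + 1) h) K
    refine (expectation_mono hg fun k hk => hF h k (greedy_lowerConfidenceBound hk).1).trans ?_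
    rw [expectation_const hg]

theorem expectation_expProcess_le (d : Fin m → ℕ+) (K T : ℕ) (i : Fin m) (l : ℝ) :
    expectation (clcbHistory d K T) (expProcess d K i l) ≤ 1 := by
  refine (expectation_clcbHistory_le _ (fun h k hk =>
    expectation_expProcess_cons_le i l h (le_of_sum_eq hk i)) T).trans ?_
  simp [expProcess, collisionCount_nil, pairCount_nil]

/-- Ville's inequality. -/
theorem expectation_ind_exists_suffix_le (F : History d K → ℝ) (h0 : ∀ h, 0 ≤ F h)
    (hF : ∀ (h : History d K) (k : Fin m → ℕ), ∑ i, k i = K →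
      expectation (realizationLaw d K) (fun φ => F ((k, φ) :: h)) ≤ F h) {a : ℝ} (ha : 0 < a)
    (T : ℕ) :
    expectation (clcbHistory d K T) (fun h => ind (∃ h', h' <:+ h ∧ a ≤ F h')) ≤ F [] / a := by
  have hs0 : ∀ h, 0 ≤ stopAt a F h := by
    intro h
    induction h with
    | nil => exact h0 _
    | cons r h ih =>
      rw [stopAt]
      split_ifs
      · exact ih
      · exact h0 _
  have h1 : expectation (clcbHistory d K T) (stopAt a F) ≤ F [] := by
    refine expectation_clcbHistory_le (stopAt a F) (fun h k hk => ?_) T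
    by_cases hle : a ≤ stopAt a F h
    · simp only [stopAt, hle, if_true]
      rw [expectation_const (finite_support_realizationLaw d K)]
    · simp only [stopAt, hle, if_false]
      rw [stopAt_eq_of_lt hle]
      exact hF h k hk
  rw [le_div_iff₀ ha, ← expectation_mul_const]
  refine le_trans (expectation_mono (finite_support_clcbHistory d K T) fun h _ => ?_) h1
  by_cases hex : ∃ h', h' <:+ h ∧ a ≤ F h'
  · rw [ind_of_true hex, one_mul]
    obtain ⟨h', hs, hh'⟩ := hex
    exact le_stopAt hs hh'
  · rw [ind_of_false hex, zero_mul]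
    exact hs0 h

end HistoryLaw

section Gaps

variable {m : ℕ} {d : Fin m → ℕ+} {K : ℕ} {kstar : Fin m → ℕ}

theorem sum_eval_update (F : Fin m → ℕ → ℝ) (k : Fin m → ℕ) (i : Fin m) (a : ℕ) :
    ∑ l, F l (Function.update k i a l) = ∑ l, F l (k l) - F i (k i) + F i a := by
  rw [← Finset.add_sum_erase _ _ (Finset.mem_univ i),
    ← Finset.add_sum_erase Finset.univ (fun l => F l (k l)) (Finset.mem_univ i)]
  have : ∑ l ∈ Finset.univ.erase i, F l (Function.update k i a l)
      = ∑ l ∈ Finset.univ.erase i, F l (k l) :=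
    Finset.sum_congr rfl fun l hl => by
      rw [Function.update_of_ne (Finset.ne_of_mem_erase hl)]
  rw [this, Function.update_self]
  ring

theorem sum_eval_update_update (F : Fin m → ℕ → ℝ) (k : Fin m → ℕ) {i j : Fin m} (hij : i ≠ j)
    (a b : ℕ) :
    ∑ l, F l (Function.update (Function.update k i a) j b l) =
      ∑ l, F l (k l) - F i (k i) + F i a - F j (k j) + F j b := by
  rw [sum_eval_update, sum_eval_update, Function.update_of_ne hij.symm]

theorem sum_sub_one_add (k : Fin m → ℕ) (h1 : ∀ i, 1 ≤ k i) :
    ∑ i, (k i - 1) + m = ∑ i, k i := by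
  have : ∑ i, (k i - 1) + ∑ _i : Fin m, 1 = ∑ i, k i := by
    rw [← Finset.sum_add_distrib]
    exact Finset.sum_congr rfl fun i _ => Nat.sub_add_cancel (h1 i)
  simpa using this

theorem gap_nonneg (hopt : IsOptimalAllocation d K kstar) {k : Fin m → ℕ} (hk : ∑ i, k i ≤ K) :
    0 ≤ gap d K kstar k := sub_nonneg.2 (hopt.2 k hk)

theorem exists_isGreedy [NeZero m] (d : Fin m → ℕ+) (K : ℕ) :
    ∃ k : Fin m → ℕ, ∑ i, k i = K ∧ IsGreedy (collisionProb d) k := by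
  obtain ⟨k, hk⟩ := (greedyAllocation (collisionProb d) K).support_nonempty
  exact ⟨k, greedyAllocation_support (fun i => (collisionProb_pos d i).le)
    (collisionProb_le_one d) hk⟩

theorem gap_of_isGreedy [NeZero m] (hopt : IsOptimalAllocation d K kstar) {k : Fin m → ℕ}
    (hk : ∑ i, k i = K) (hg : IsGreedy (collisionProb d) k) : gap d K kstar k = 0 := by
  refine le_antisymm ?_ (gap_nonneg hopt hk.le)
  unfold gap
  rw [sub_nonpos, expectedReward_eq_of_sum_le d hopt.1, expectedReward_eq_of_sum_le d hk.le]
  exact hg.sum_geomReward_le (fun i => (collisionProb_pos d i).le) (collisionProb_le_one d)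
    (hopt.1.trans hk.ge)

theorem finite_badActions (d : Fin m → ℕ+) (K : ℕ) (kstar : Fin m → ℕ) (i : Fin m) :
    (badActions d K kstar i).Finite := by
  refine (Set.finite_Iic (fun _ : Fin m => K)).subset fun k hk => ?_
  exact fun j => le_of_sum_eq hk.1 j

theorem gapMaxAt_nonneg (i : Fin m) : 0 ≤ gapMaxAt d K kstar i := by
  refine Real.sSup_nonneg ?_
  rintro _ ⟨k, hk, rfl⟩
  exact hk.2.1.le

theorem gapMax_nonneg : 0 ≤ gapMax d K kstar := Real.iSup_nonneg fun i => gapMaxAt_nonneg i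

theorem gap_le_gapMax (hm : m < K) {k : Fin m → ℕ} (hk : ∑ i, k i = K) :
    gap d K kstar k ≤ gapMax d K kstar := by
  rcases le_or_gt (gap d K kstar k) 0 with h | h
  · exact h.trans gapMax_nonneg
  · obtain ⟨i, hi⟩ := exists_one_lt (hm.trans_eq hk.symm)
    calc gap d K kstar k ≤ gapMaxAt d K kstar i :=
          le_csSup ((finite_badActions d K kstar i).image _).bddAbove
            (Set.mem_image_of_mem _ ⟨hk, h, hi⟩)
      _ ≤ gapMax d K kstar :=
          le_ciSup (f := gapMaxAt d K kstar) (Set.finite_range _).bddAbove i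

theorem invGapMin_nonneg (i : Fin m) : 0 ≤ invGapMin d K kstar i := ENNReal.toReal_nonneg

theorem inv_gap_le_invGapMin {i : Fin m} {k : Fin m → ℕ} (hk : k ∈ badActions d K kstar i) :
    (gap d K kstar k)⁻¹ ≤ invGapMin d K kstar i := by
  have hle : gapMin d K kstar i ≤ ENNReal.ofReal (gap d K kstar k) :=
    sInf_le (Set.mem_image_of_mem _ hk)
  have hne : gapMin d K kstar i ≠ 0 := by
    obtain ⟨k', hk', h⟩ := Set.Nonempty.csInf_mem
      (s := (fun k => ENNReal.ofReal (gap d K kstar k)) '' badActions d K kstar i)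
      ⟨_, Set.mem_image_of_mem _ hk⟩ ((finite_badActions d K kstar i).image _)
    unfold gapMin
    rw [← h]
    simpa using hk'.2.1
  unfold invGapMin
  rw [← ENNReal.toReal_ofReal hk.2.1.le, ← ENNReal.toReal_inv]
  exact ENNReal.toReal_mono (ENNReal.inv_ne_top.2 hne) (ENNReal.inv_le_inv.2 hle)

theorem geomReward_succ (x : ℝ) (k : ℕ) : geomReward x (k + 1) = geomReward x k + (1 - x) ^ k :=
  Finset.sum_range_succ _ _

/-- Moving units from community `j` to community `i` one by one, starting from an optimal
allocation, one meets a suboptimal allocation with a small gap. -/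
theorem exists_badAction [NeZero m] (hopt : IsOptimalAllocation d K kstar) (hm : m < K)
    {i j : Fin m} (hij : i ≠ j) :
    ∃ k ∈ badActions d K kstar i,
      gap d K kstar k ≤ ((K - m + 1 : ℕ) : ℝ) * collisionProb d i := by
  classical
  obtain ⟨k, hk, hg⟩ := exists_isGreedy d K
  have hpos := hg.one_le (collisionProb_pos d) (collisionProb_le_one d) (hm.le.trans_eq hk.symm)
  let mv : ℕ → Fin m → ℕ := fun b => Function.update (Function.update k i (k i + b)) j (k j - b)
  have hsum : ∀ b ≤ k j, ∑ l, mv b l = K := by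
    intro b hb
    have h1 := sum_eval_update_update (fun _ n => (n : ℝ)) k hij (k i + b) (k j - b)
    push_cast [Nat.cast_sub hb] at h1
    have h2 : ((∑ l, mv b l : ℕ) : ℝ) = (∑ l, k l : ℕ) := by
      push_cast
      linarith
    rw [← hk]
    exact_mod_cast h2
  have hstep : ∀ b < k j, gap d K kstar (mv (b + 1)) - gap d K kstar (mv b) =
      (1 - collisionProb d j) ^ (k j - (b + 1)) - (1 - collisionProb d i) ^ (k i + b) := by
    intro b hb
    unfold gap
    rw [expectedReward_eq_of_sum_le d (hsum b hb.le).le,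
      expectedReward_eq_of_sum_le d (hsum (b + 1) hb).le]
    simp only [mv]
    rw [sum_eval_update_update (fun l => geomReward (collisionProb d l)) k hij,
      sum_eval_update_update (fun l => geomReward (collisionProb d l)) k hij]
    have e1 : k j - b = k j - (b + 1) + 1 := by omega
    rw [e1, geomReward_succ, ← add_assoc, geomReward_succ]
    ring
  have hlast : 0 < gap d K kstar (mv (k j)) := by
    have h1 := hstep (k j - 1) (by have := hpos j; omega)
    rw [Nat.sub_add_cancel (hpos j), Nat.sub_self, pow_zero] at h1
    have h2 := gap_nonneg hopt (hsum (k j - 1) (by omega)).le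
    have h3 : (1 - collisionProb d i) ^ (k i + (k j - 1)) < 1 :=
      pow_lt_one₀ (by linarith [collisionProb_le_one d i]) (by linarith [collisionProb_pos d i])
        (by have := hpos i; omega)
    linarith
  have hex : ∃ b, b ≤ k j ∧ 0 < gap d K kstar (mv b) := ⟨k j, le_rfl, hlast⟩
  obtain ⟨hb, hb0⟩ := Nat.find_spec hex
  have hmin := fun b (h : b < Nat.find hex) => Nat.find_min hex h
  set b := Nat.find hex
  have hbne : b ≠ 0 := by
    intro h0
    have h1 : mv 0 = k := by simp [mv]
    rw [h0, h1, gap_of_isGreedy hopt hk hg] at hb0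
    exact lt_irrefl _ hb0
  obtain ⟨c, hc⟩ := Nat.exists_eq_succ_of_ne_zero hbne
  refine ⟨mv b, ⟨hsum b hb, hb0, ?_⟩, ?_⟩
  · have := hpos i
    simp only [mv, Function.update_of_ne hij, Function.update_self]
    omega
  · have h1 := hstep c (by omega)
    have h2 : gap d K kstar (mv c) ≤ 0 := by
      by_contra! h
      exact hmin c (by omega) ⟨by omega, h⟩
    rw [hc]
    have h3 : (1 - collisionProb d j) ^ (k j - (c + 1)) ≤ 1 :=
      pow_le_one₀ (by linarith [collisionProb_le_one d j]) (by linarith [collisionProb_pos d j])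
    have h4 : 1 - ((k i + c : ℕ) : ℝ) * collisionProb d i
        ≤ (1 - collisionProb d i) ^ (k i + c) := by
      have := one_add_mul_le_pow (a := -collisionProb d i)
        (by linarith [collisionProb_le_one d i]) (k i + c)
      rw [← sub_eq_add_neg] at this
      linarith
    have h5 : k i + c ≤ K - m + 1 := by
      have h6 := sum_sub_one_add k hpos
      have h7 : (k i - 1) + (k j - 1) ≤ ∑ l, (k l - 1) := by
        rw [← Finset.sum_pair (f := fun l => k l - 1) hij]
        exact Finset.sum_le_sum_of_subset (Finset.subset_univ _)
      have := hpos i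
      have := hpos j
      omega
    have h6 : ((k i + c : ℕ) : ℝ) * collisionProb d i
        ≤ ((K - m + 1 : ℕ) : ℝ) * collisionProb d i :=
      mul_le_mul_of_nonneg_right (by exact_mod_cast h5) (collisionProb_pos d i).le
    simp only [Nat.succ_eq_add_one] at *
    linarith

theorem inv_le_invGapMin [NeZero m] (hopt : IsOptimalAllocation d K kstar) (hm : m < K)
    {i j : Fin m} (hij : i ≠ j) :
    (((K - m + 1 : ℕ) : ℝ) * collisionProb d i)⁻¹ ≤ invGapMin d K kstar i := by
  obtain ⟨k, hk, hle⟩ := exists_badAction hopt hm hij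
  exact (inv_anti₀ hk.2.1 hle).trans (inv_gap_le_invGapMin hk)

theorem gap_eq_zero_of_subsingleton [NeZero m] [Subsingleton (Fin m)]
    (hopt : IsOptimalAllocation d K kstar) {k : Fin m → ℕ} (hk : ∑ i, k i = K) :
    gap d K kstar k = 0 := by
  obtain ⟨k', hk', hg⟩ := exists_isGreedy d K
  have : k = k' := by
    funext i
    rw [Fintype.sum_subsingleton _ i] at hk hk'
    rw [hk, hk']
  rw [this]
  exact gap_of_isGreedy hopt hk' hg

end Gaps

section Concentration

variable {m : ℕ} {d : Fin m → ℕ+} {K : ℕ}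

/-- The empirical means respect their confidence intervals in round `t`. -/
def IsGood (t : ℕ) (h : History d K) : Prop :=
  ∀ i, pairCount h i ≠ 0 → |empiricalMean h i - collisionProb d i| ≤ confidenceRadius t h i

theorem pairCount_le [NeZero m] {h : History d K} (hr : IsReachable h) (i : Fin m) :
    pairCount h i ≤ K / 2 * h.length := by
  induction h with
  | nil => simp [pairCount_nil]
  | cons r h ih =>
    obtain ⟨k, φ⟩ := r
    obtain ⟨hk, hr⟩ := hr
    have h1 := le_of_sum_eq (greedy_lowerConfidenceBound hk).1 i
    have h2 : k i / 2 ≤ K / 2 := Nat.div_le_div_right h1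
    have h3 := ih hr
    rw [pairCount_cons, List.length_cons, mul_add, mul_one]
    omega

theorem le_expProcess_of_deviation {h : History d K} {i : Fin m} {r : ℝ} (hr : 0 ≤ r)
    (hp : pairCount h i ≠ 0) (hdev : r ≤ empiricalMean h i - collisionProb d i) :
    Real.exp (2 * r ^ 2 * pairCount h i) ≤ expProcess d K i (4 * r) h := by
  have hp' : (0 : ℝ) < pairCount h i := by positivity
  rw [empiricalMean, if_neg hp] at hdev
  have h1 : r * pairCount h i ≤ collisionCount h i - collisionProb d i * pairCount h i := by
    have := mul_le_mul_of_nonneg_right hdev hp'.le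
    rwa [sub_mul, div_mul_cancel₀ _ hp'.ne'] at this
  unfold expProcess
  refine Real.exp_le_exp.2 ?_
  have := mul_le_mul_of_nonneg_left h1 (show 0 ≤ 4 * r by positivity)
  nlinarith

theorem le_expProcess_of_neg_deviation {h : History d K} {i : Fin m} {r : ℝ} (hr : 0 ≤ r)
    (hp : pairCount h i ≠ 0) (hdev : r ≤ collisionProb d i - empiricalMean h i) :
    Real.exp (2 * r ^ 2 * pairCount h i) ≤ expProcess d K i (-(4 * r)) h := by
  have hp' : (0 : ℝ) < pairCount h i := by positivity
  rw [empiricalMean, if_neg hp] at hdev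
  have h1 : r * pairCount h i ≤ collisionProb d i * pairCount h i - collisionCount h i := by
    have := mul_le_mul_of_nonneg_right hdev hp'.le
    rwa [sub_mul, div_mul_cancel₀ _ hp'.ne'] at this
  unfold expProcess
  refine Real.exp_le_exp.2 ?_
  have := mul_le_mul_of_nonneg_left h1 (show 0 ≤ 4 * r by positivity)
  nlinarith

theorem expProcess_nonneg (i : Fin m) (l : ℝ) (h : History d K) : 0 ≤ expProcess d K i l h :=
  (Real.exp_pos _).le

/-- The probability that some confidence interval is violated. -/
theorem expectation_ind_not_isGood_le [NeZero m] (d : Fin m → ℕ+) (K n : ℕ) :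
    expectation (clcbHistory d K n) (fun h => ind (¬ IsGood (n + 1) h))
      ≤ 2 * m * ((K / 2 : ℕ) : ℝ) / ((n : ℝ) + 1) ^ 2 := by
  have hfin := finite_support_clcbHistory d K n
  set L := Real.log ((n + 1 : ℕ) : ℝ) with hL
  have hL0 : 0 ≤ L := Real.log_natCast_nonneg _
  let r : ℕ → ℝ := fun s => Real.sqrt (3 * L / (2 * s))
  have ht : (0 : ℝ) < (n : ℝ) + 1 := by positivity
  have hpt : ∀ h ∈ (clcbHistory d K n).support, ind (¬ IsGood (n + 1) h) ≤
      ∑ i : Fin m, ∑ s ∈ Finset.Icc 1 (K / 2 * n),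
        (expProcess d K i (4 * r s) h + expProcess d K i (-(4 * r s)) h)
          * (((n : ℝ) + 1) ^ 3)⁻¹ := by
    intro h hh
    obtain ⟨hlen, hreach⟩ := clcbHistory_support hh
    have hterm : ∀ i s, 0 ≤ (expProcess d K i (4 * r s) h + expProcess d K i (-(4 * r s)) h)
          * (((n : ℝ) + 1) ^ 3)⁻¹ := fun i s =>
      mul_nonneg (add_nonneg (expProcess_nonneg _ _ _) (expProcess_nonneg _ _ _)) (by positivity)
    refine ind_le_of_imp (Finset.sum_nonneg fun i _ => Finset.sum_nonneg fun s _ => hterm i s) ?_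
    intro hbad
    unfold IsGood at hbad
    push Not at hbad
    obtain ⟨i, hp, hdev⟩ := hbad
    set s := pairCount h i with hs
    have hsmem : s ∈ Finset.Icc 1 (K / 2 * n) := by
      have := pairCount_le hreach i
      rw [hlen] at this
      exact Finset.mem_Icc.2 ⟨Nat.one_le_iff_ne_zero.2 hp, this⟩
    refine le_trans ?_ (Finset.single_le_sum (fun i _ => Finset.sum_nonneg fun s _ => hterm i s)
      (Finset.mem_univ i))
    refine le_trans ?_ (Finset.single_le_sum (fun s _ => hterm i s) hsmem)
    rw [confidenceRadius, if_neg hp] at hdev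
    have hr0 : 0 ≤ r s := Real.sqrt_nonneg _
    have hexp : Real.exp (2 * r s ^ 2 * s) = ((n : ℝ) + 1) ^ 3 := by
      have hs0 : (s : ℝ) ≠ 0 := by exact_mod_cast hp
      have : 2 * r s ^ 2 * s = (3 : ℕ) * L := by
        simp only [r]
        rw [Real.sq_sqrt (by positivity)]
        push_cast
        field_simp
      rw [this, Real.exp_nat_mul, hL, Real.exp_log (by positivity)]
      push_cast
      rfl
    rw [← div_eq_mul_inv, le_div_iff₀ (by positivity), one_mul, ← hexp]
    rcases lt_abs.1 hdev with h1 | h1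
    · have := le_expProcess_of_deviation hr0 hp h1.le
      have := expProcess_nonneg i (-(4 * r s)) h
      linarith
    · rw [neg_sub] at h1
      have := le_expProcess_of_neg_deviation hr0 hp h1.le
      have := expProcess_nonneg i (4 * r s) h
      linarith
  refine (expectation_mono hfin hpt).trans ?_
  rw [expectation_sum hfin]
  simp_rw [expectation_sum hfin, expectation_mul_const, expectation_add hfin]
  have hle : ∀ i s, (expectation (clcbHistory d K n) (expProcess d K i (4 * r s))
      + expectation (clcbHistory d K n) (expProcess d K i (-(4 * r s)))) * (((n : ℝ) + 1) ^ 3)⁻¹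
      ≤ 2 * (((n : ℝ) + 1) ^ 3)⁻¹ := by
    intro i s
    refine mul_le_mul_of_nonneg_right ?_ (by positivity)
    linarith [expectation_expProcess_le d K n i (4 * r s),
      expectation_expProcess_le d K n i (-(4 * r s))]
  refine (Finset.sum_le_sum fun i _ => Finset.sum_le_sum fun s _ => hle i s).trans ?_
  simp only [Finset.sum_const, Finset.card_univ, Fintype.card_fin, Nat.card_Icc, nsmul_eq_mul]
  rw [add_tsub_cancel_right]
  push_cast
  rw [le_div_iff₀ (by positivity)]
  have h1 : (m : ℝ) * (((K / 2 : ℕ) : ℝ) * n * (2 * (((n : ℝ) + 1) ^ 3)⁻¹)) * ((n : ℝ) + 1) ^ 2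
      = 2 * m * ((K / 2 : ℕ) : ℝ) * (n / ((n : ℝ) + 1)) := by
    field_simp
  rw [h1]
  refine mul_le_of_le_one_right (by positivity) ?_
  rw [div_le_one ht]
  linarith

end Concentration

section PathSums

variable {m : ℕ} {d : Fin m → ℕ+} {K : ℕ}

/-- The sum over the rounds of a cost that depends on the allocation of the round and on the
history before the round. -/
noncomputable def pathSum (c : (Fin m → ℕ) → History d K → ℝ) : History d K → ℝ
  | [] => 0
  | r :: h => c r.1 h + pathSum c h

theorem pathSum_add (c c' : (Fin m → ℕ) → History d K → ℝ) (h : History d K) :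
    pathSum (fun k h => c k h + c' k h) h = pathSum c h + pathSum c' h := by
  induction h with
  | nil => simp [pathSum]
  | cons r h ih => simp only [pathSum, ih]; ring

theorem pathSum_const_mul (a : ℝ) (c : (Fin m → ℕ) → History d K → ℝ) (h : History d K) :
    pathSum (fun k h => a * c k h) h = a * pathSum c h := by
  induction h with
  | nil => simp [pathSum]
  | cons r h ih => simp only [pathSum, ih]; ring

variable [NeZero m]

theorem pathSum_mono_of_suffix {c c' : (Fin m → ℕ) → History d K → ℝ} {h : History d K}
    (hr : IsReachable h)
    (hc : ∀ k (h' : History d K), IsReachable h' →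
      k ∈ (greedyAllocation (lowerConfidenceBound (h'.length + 1) h') K).support →
      h'.length < h.length → h' <:+ h → c k h' ≤ c' k h') :
    pathSum c h ≤ pathSum c' h := by
  induction h with
  | nil => exact le_rfl
  | cons r h ih =>
    obtain ⟨hk, hr⟩ := hr
    refine add_le_add (hc _ _ hr hk (by simp) (List.suffix_cons r h))
      (ih hr fun k h' h1 h2 h3 h4 => hc k h' h1 h2 ?_ (h4.trans (List.suffix_cons r h)))
    rw [List.length_cons]
    omega

theorem pathSum_mono {c c' : (Fin m → ℕ) → History d K → ℝ} {h : History d K}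
    (hr : IsReachable h)
    (hc : ∀ k (h' : History d K), IsReachable h' →
      k ∈ (greedyAllocation (lowerConfidenceBound (h'.length + 1) h') K).support →
      h'.length < h.length → c k h' ≤ c' k h') :
    pathSum c h ≤ pathSum c' h :=
  pathSum_mono_of_suffix hr fun k h' h1 h2 h3 _ => hc k h' h1 h2 h3

/-- A cost that is dominated by the increments of a monotone potential of the pair counts. -/
theorem pathSum_le_of_potential {c : (Fin m → ℕ) → History d K → ℝ} {h : History d K}
    (hr : IsReachable h) (Ψ : Fin m → ℕ → ℝ)
    (hc : ∀ k (h' : History d K), IsReachable h' →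
      k ∈ (greedyAllocation (lowerConfidenceBound (h'.length + 1) h') K).support →
      h'.length < h.length →
      c k h' ≤ ∑ i, (Ψ i (k i / 2 + pairCount h' i) - Ψ i (pairCount h' i))) :
    pathSum c h ≤ ∑ i, (Ψ i (pairCount h i) - Ψ i 0) := by
  refine (pathSum_mono hr hc).trans (le_of_eq ?_)
  clear hc hr
  induction h with
  | nil => simp [pathSum, pairCount_nil]
  | cons r h ih =>
    obtain ⟨k, φ⟩ := r
    rw [pathSum, ih, ← Finset.sum_add_distrib]
    refine Finset.sum_congr rfl fun i _ => ?_
    rw [pairCount_cons]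
    ring

theorem expectation_pathSum_succ (d : Fin m → ℕ+) (K n : ℕ)
    (c : (Fin m → ℕ) → History d K → ℝ) :
    expectation (clcbHistory d K (n + 1)) (pathSum c) =
      expectation (clcbHistory d K n) (fun h =>
        expectation (greedyAllocation (lowerConfidenceBound (n + 1) h) K) fun k => c k h)
      + expectation (clcbHistory d K n) (pathSum c) := by
  rw [expectation_clcbHistory_succ, ← expectation_add (finite_support_clcbHistory d K n)]
  refine congrArg _ (funext fun h => ?_)
  have hg := finite_support_greedyAllocation (lowerConfidenceBound (n + 1) h) K
  have : ∀ k, expectation (realizationLaw d K) (fun φ => pathSum c ((k, φ) :: h))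
      = c k h + pathSum c h := fun k => by
    simp only [pathSum]
    exact expectation_const (finite_support_realizationLaw d K) _
  simp_rw [this]
  rw [expectation_add hg, expectation_const hg]

theorem expectation_pathSum_history (d : Fin m → ℕ+) (K T : ℕ) (c : History d K → ℝ) :
    expectation (clcbHistory d K T) (pathSum fun _ h => c h) =
      ∑ n ∈ Finset.range T, expectation (clcbHistory d K n) c := by
  induction T with
  | zero => rw [expectation_clcbHistory_zero]; simp [pathSum]
  | succ n ih =>
    rw [expectation_pathSum_succ, ih, Finset.sum_range_succ, add_comm]
    congr 1
    refine congrArg _ (funext fun h => ?_)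
    exact expectation_const (finite_support_greedyAllocation _ K) _

theorem regret_eq (d : Fin m → ℕ+) (K : ℕ) (kstar : Fin m → ℕ) (T : ℕ) :
    regret d K kstar T =
      expectation (clcbHistory d K T) (pathSum fun k _ => gap d K kstar k) := by
  unfold regret
  induction T with
  | zero => simp [expectation_clcbHistory_zero, pathSum]
  | succ n ih =>
    have hr := finite_support_realizationLaw d K
    rw [expectation_clcbHistory_succ, expectation_pathSum_succ, ← ih,
      ← expectation_add (finite_support_clcbHistory d K n)]
    refine congrArg _ (funext fun h => ?_)
    have hg := finite_support_greedyAllocation (lowerConfidenceBound (n + 1) h) K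
    rw [← expectation_const hg (List.sum (h.map fun r : (Fin m → ℕ) × Realization d K =>
      (reward kstar r.2 : ℝ) - (reward r.1 r.2 : ℝ))), ← expectation_add hg]
    refine congrArg _ (funext fun k => ?_)
    simp only [List.map_cons, List.sum_cons]
    rw [expectation_add hr, expectation_sub hr, expectation_const hr]
    rfl

end PathSums

section Rounds

variable {m : ℕ} {d : Fin m → ℕ+} {K : ℕ} {kstar : Fin m → ℕ}

theorem IsGood.lowerConfidenceBound_le {t : ℕ} {h : History d K} (hg : IsGood t h) (i : Fin m) :
    lowerConfidenceBound t h i ≤ collisionProb d i := by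
  refine max_le (collisionProb_pos d i).le ?_
  by_cases hp : pairCount h i = 0
  · simp [empiricalMean, confidenceRadius, hp, (collisionProb_pos d i).le]
  · have := (abs_le.1 (hg i hp)).2
    linarith

theorem IsGood.sub_lowerConfidenceBound_le {t : ℕ} {h : History d K} (hg : IsGood t h)
    {i : Fin m} (hp : pairCount h i ≠ 0) :
    collisionProb d i - lowerConfidenceBound t h i ≤ 2 * confidenceRadius t h i := by
  have h1 := (abs_le.1 (hg i hp)).1
  have h2 : empiricalMean h i - confidenceRadius t h i ≤ lowerConfidenceBound t h i :=
    le_max_right _ _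
  linarith

theorem confidenceRadius_sq {t : ℕ} {h : History d K} {i : Fin m} (hp : pairCount h i ≠ 0) :
    confidenceRadius t h i ^ 2 = 3 * Real.log t / (2 * (pairCount h i : ℝ)) := by
  rw [confidenceRadius, if_neg hp, Real.sq_sqrt]
  have := Real.log_natCast_nonneg t
  positivity

theorem pairCount_le_of_le_confidenceRadius {t : ℕ} {h : History d K} {i : Fin m} {x : ℝ}
    (hx : 0 < x) (hle : x ≤ confidenceRadius t h i) :
    (pairCount h i : ℝ) ≤ 3 * Real.log t / (2 * x ^ 2) := by
  by_cases hp : pairCount h i = 0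
  · have := Real.log_natCast_nonneg t
    rw [hp]
    push_cast
    positivity
  · have hp' : (0 : ℝ) < pairCount h i := by positivity
    have h1 := confidenceRadius_sq (t := t) hp
    have h2 : x ^ 2 ≤ confidenceRadius t h i ^ 2 := pow_le_pow_left₀ hx.le hle 2
    rw [h1, le_div_iff₀ (by positivity)] at h2
    rw [le_div_iff₀ (by positivity)]
    linarith

theorem IsGood.pairCount_le_of_eq_zero {t : ℕ} {h : History d K} (hg : IsGood t h) {i : Fin m}
    (h0 : lowerConfidenceBound t h i = 0) :
    (pairCount h i : ℝ) ≤ 6 * Real.log t / collisionProb d i ^ 2 := by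
  by_cases hp : pairCount h i = 0
  · have := Real.log_natCast_nonneg t
    rw [hp]
    push_cast
    positivity
  · have h1 := hg.sub_lowerConfidenceBound_le hp
    rw [h0, sub_zero] at h1
    have h2 := pairCount_le_of_le_confidenceRadius (t := t) (h := h) (i := i)
      (x := collisionProb d i / 2)
      (by linarith [collisionProb_pos d i]) (by linarith)
    refine h2.trans (le_of_eq ?_)
    field_simp
    ring

variable [NeZero m]

theorem IsGood.gap_le_sum {t : ℕ} {h : History d K} (hg : IsGood t h)
    (hopt : IsOptimalAllocation d K kstar) {k : Fin m → ℕ}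
    (hk : k ∈ (greedyAllocation (lowerConfidenceBound t h) K).support) :
    gap d K kstar k ≤ ∑ i, (geomReward (lowerConfidenceBound t h i) (k i)
      - geomReward (collisionProb d i) (k i)) := by
  obtain ⟨hsum, hgr⟩ := greedy_lowerConfidenceBound hk
  unfold gap
  rw [expectedReward_eq_of_sum_le d hopt.1, expectedReward_eq_of_sum_le d hsum.le,
    Finset.sum_sub_distrib]
  refine sub_le_sub_right ?_ _
  calc ∑ i, geomReward (collisionProb d i) (kstar i)
      ≤ ∑ i, geomReward (lowerConfidenceBound t h i) (kstar i) :=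
        Finset.sum_le_sum fun i _ => geomReward_anti (hg.lowerConfidenceBound_le i)
          (collisionProb_le_one d i) _
    _ ≤ _ := hgr.sum_geomReward_le (lowerConfidenceBound_nonneg t h)
          (lowerConfidenceBound_le_one t h) (hopt.1.trans hsum.ge)

theorem sub_one_le_two_mul_div_two (n : ℕ) : (n : ℝ) - 1 ≤ 2 * ((n / 2 : ℕ) : ℝ) := by
  have h1 : n ≤ 2 * (n / 2) + 1 := by omega
  have h2 : (n : ℝ) ≤ ((2 * (n / 2) + 1 : ℕ) : ℝ) := by exact_mod_cast h1
  push_cast at h2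
  linarith

/-- The gap of a round in which all lower confidence bounds are positive. -/
theorem IsGood.gap_le_of_pos {t : ℕ} {h : History d K} (hg : IsGood t h)
    (hopt : IsOptimalAllocation d K kstar) (hm : m < K) {k : Fin m → ℕ}
    (hk : k ∈ (greedyAllocation (lowerConfidenceBound t h) K).support)
    (hpos : ∀ i, 0 < lowerConfidenceBound t h i) :
    gap d K kstar k ≤ ∑ i, 2 * ((k i / 2 : ℕ) : ℝ) *
      max 0 (((K - m + 1 : ℕ) : ℝ) * min 1 (2 * confidenceRadius t h i)
        - (invGapMin d K kstar i)⁻¹ / ((K - m : ℕ) : ℝ)) := by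
  rcases le_or_gt (gap d K kstar k) 0 with hle | hgap
  · exact hle.trans (Finset.sum_nonneg fun i _ => mul_nonneg (by positivity) (le_max_left _ _))
  obtain ⟨hsum, hgr⟩ := greedy_lowerConfidenceBound hk
  have hk1 := hgr.one_le hpos (lowerConfidenceBound_le_one t h) (hm.le.trans_eq hsum.symm)
  have hsub := sum_sub_one_add k hk1
  have hKm : (0 : ℝ) < ((K - m : ℕ) : ℝ) := by exact_mod_cast Nat.sub_pos_of_lt hm
  have hsub' : ∑ i, ((k i : ℝ) - 1) = ((K - m : ℕ) : ℝ) := by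
    have h1 : ∑ i, (k i - 1) = K - m := by omega
    rw [← h1, Nat.cast_sum]
    exact Finset.sum_congr rfl fun i _ => by rw [Nat.cast_sub (hk1 i)]; simp
  have hp : ∀ i, pairCount h i ≠ 0 := by
    intro i hp
    have := hpos i
    simp [lowerConfidenceBound, empiricalMean, confidenceRadius, hp] at this
  set δ : Fin m → ℝ := fun i => min 1 (2 * confidenceRadius t h i) with hδ
  have hδ0 : ∀ i, 0 ≤ δ i := fun i =>
    le_min zero_le_one (by linarith [confidenceRadius_nonneg t h i])
  have h1 : gap d K kstar k ≤ ∑ i, (k i : ℝ) * (k i - 1) / 2 * δ i := by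
    refine (hg.gap_le_sum hopt hk).trans (Finset.sum_le_sum fun i _ => ?_)
    refine (geomReward_sub_geomReward_le (lowerConfidenceBound_nonneg t h i)
      (hg.lowerConfidenceBound_le i) (collisionProb_le_one d i) (k i)).trans ?_
    have hki : (1 : ℝ) ≤ k i := by exact_mod_cast hk1 i
    refine mul_le_mul_of_nonneg_left (le_min ?_ (hg.sub_lowerConfidenceBound_le (hp i)))
      (div_nonneg (mul_nonneg (by linarith) (by linarith)) zero_le_two)
    linarith [collisionProb_le_one d i, lowerConfidenceBound_nonneg t h i]
  have h2 : gap d K kstar k =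
      2 * gap d K kstar k - ∑ i, ((k i : ℝ) - 1) * (gap d K kstar k / ((K - m : ℕ) : ℝ)) := by
    rw [← Finset.sum_mul, hsub', mul_div_cancel₀ _ hKm.ne']
    ring
  calc gap d K kstar k
      ≤ 2 * (∑ i, (k i : ℝ) * (k i - 1) / 2 * δ i)
        - ∑ i, ((k i : ℝ) - 1) * (gap d K kstar k / ((K - m : ℕ) : ℝ)) := by linarith
    _ = ∑ i, ((k i : ℝ) - 1) * (k i * δ i - gap d K kstar k / ((K - m : ℕ) : ℝ)) := by
        rw [Finset.mul_sum, ← Finset.sum_sub_distrib]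
        exact Finset.sum_congr rfl fun i _ => by ring
    _ ≤ _ := by
        refine Finset.sum_le_sum fun i _ => ?_
        rcases (hk1 i).eq_or_lt with hi | hi
        · rw [← hi]
          simp
        · have hki : (1 : ℝ) ≤ k i := by exact_mod_cast hk1 i
          have hkK : (k i : ℝ) ≤ ((K - m + 1 : ℕ) : ℝ) := by
            have : k i - 1 ≤ ∑ i, (k i - 1) :=
              Finset.single_le_sum (f := fun i => k i - 1) (fun j _ => Nat.zero_le _)
                (Finset.mem_univ i)
            exact_mod_cast (by omega : k i ≤ K - m + 1)
          have hinv : (invGapMin d K kstar i)⁻¹ ≤ gap d K kstar k :=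
            inv_le_of_inv_le₀ hgap (inv_gap_le_invGapMin ⟨hsum, hgap, hi⟩)
          have h3 : (k i : ℝ) * δ i - gap d K kstar k / ((K - m : ℕ) : ℝ) ≤
              max 0 (((K - m + 1 : ℕ) : ℝ) * δ i
                - (invGapMin d K kstar i)⁻¹ / ((K - m : ℕ) : ℝ)) :=
            le_max_of_le_right (sub_le_sub (mul_le_mul_of_nonneg_right hkK (hδ0 i))
              (div_le_div_of_nonneg_right hinv hKm.le))
          exact (mul_le_mul_of_nonneg_left h3 (by linarith)).trans
            (mul_le_mul_of_nonneg_right (sub_one_le_two_mul_div_two _) (le_max_left _ _))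

/-- The gap of a round in which some lower confidence bound vanishes. -/
theorem IsGood.gap_le_of_zero {t : ℕ} {h : History d K} (hg : IsGood t h)
    (hopt : IsOptimalAllocation d K kstar) {k : Fin m → ℕ}
    (hk : k ∈ (greedyAllocation (lowerConfidenceBound t h) K).support) {j : Fin m}
    (hj : lowerConfidenceBound t h j = 0) :
    gap d K kstar k ≤ ∑ i, if lowerConfidenceBound t h i = 0 ∧ 1 < k i then
      (K : ℝ) * min 1 (((k i / 2 : ℕ) : ℝ) * collisionProb d i) else 0 := by
  obtain ⟨hsum, hgr⟩ := greedy_lowerConfidenceBound hk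
  refine (hg.gap_le_sum hopt hk).trans (Finset.sum_le_sum fun i _ => ?_)
  have hp0 := collisionProb_pos d i
  have hp1 := collisionProb_le_one d i
  by_cases hi : 1 < k i
  · have hz : lowerConfidenceBound t h i = 0 := by
      by_contra hne
      have := hgr.le_one_of_zero (lt_of_le_of_ne (lowerConfidenceBound_nonneg t h i)
        (Ne.symm hne)) (lowerConfidenceBound_le_one t h i) hj
      omega
    rw [if_pos ⟨hz, hi⟩, hz]
    have hkK : (k i : ℝ) ≤ K := by exact_mod_cast le_of_sum_eq hsum i
    have hki : (1 : ℝ) ≤ k i := by exact_mod_cast hi.le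
    rw [mul_min_of_nonneg _ _ (by linarith), mul_one]
    refine le_min ?_ ?_
    · have := geomReward_le (le_refl (0 : ℝ)) zero_le_one (k i)
      have := geomReward_nonneg hp1 (k i)
      linarith
    · refine (geomReward_sub_geomReward_le le_rfl hp0.le hp1 (k i)).trans ?_
      have h1 := sub_one_le_two_mul_div_two (k i)
      rw [sub_zero, ← mul_assoc]
      refine mul_le_mul_of_nonneg_right ?_ hp0.le
      have h2 := mul_le_mul hkK h1 (by linarith) (by linarith)
      linarith
  · rw [if_neg fun h => hi h.2]
    have : geomReward (lowerConfidenceBound t h i) (k i) = geomReward (collisionProb d i) (k i) := by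
      have : k i = 0 ∨ k i = 1 := by omega
      rcases this with h0 | h0 <;> simp [h0, geomReward]
    rw [this, sub_self]

end Rounds

section Potentials

theorem sum_inv_sqrt_le (n : ℕ) :
    ∑ y ∈ Finset.range n, 1 / Real.sqrt ((y + 1 : ℕ) : ℝ) ≤ 2 * Real.sqrt n := by
  induction n with
  | zero => simp
  | succ n ih =>
    rw [Finset.sum_range_succ]
    have hs : (0 : ℝ) < Real.sqrt ((n + 1 : ℕ) : ℝ) := Real.sqrt_pos.2 (by positivity)
    have h1 : Real.sqrt ((n + 1 : ℕ) : ℝ) ^ 2 = n + 1 := by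
      rw [Real.sq_sqrt (by positivity)]; push_cast; rfl
    have h2 : Real.sqrt (n : ℝ) ^ 2 = n := Real.sq_sqrt (by positivity)
    have h3 : 1 / Real.sqrt ((n + 1 : ℕ) : ℝ) ≤
        2 * Real.sqrt ((n + 1 : ℕ) : ℝ) - 2 * Real.sqrt (n : ℝ) := by
      rw [div_le_iff₀ hs]
      nlinarith [sq_nonneg (Real.sqrt ((n + 1 : ℕ) : ℝ) - Real.sqrt (n : ℝ))]
    linarith

theorem sum_max_div_sqrt_sub_le {a b : ℝ} (ha : 0 ≤ a) (hb : 0 < b) (n : ℕ) :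
    ∑ y ∈ Finset.range n, max 0 (a / Real.sqrt ((y + 1 : ℕ) : ℝ) - b) ≤ a ^ 2 / b := by
  set N := ⌊(a / b) ^ 2⌋₊ with hN
  have hbd : ∀ M : ℕ, ∑ y ∈ Finset.range M, (a / Real.sqrt ((y + 1 : ℕ) : ℝ) - b) ≤ a ^ 2 / b := by
    intro M
    rw [Finset.sum_sub_distrib, Finset.sum_const, Finset.card_range, nsmul_eq_mul]
    have h1 : ∑ y ∈ Finset.range M, a / Real.sqrt ((y + 1 : ℕ) : ℝ) ≤ a * (2 * Real.sqrt M) := by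
      simp_rw [div_eq_mul_one_div a, ← Finset.mul_sum]
      exact mul_le_mul_of_nonneg_left (sum_inv_sqrt_le M) ha
    have h2 : Real.sqrt (M : ℝ) ^ 2 = M := Real.sq_sqrt (by positivity)
    rw [le_div_iff₀ hb]
    have h3 := mul_le_mul_of_nonneg_right h1 hb.le
    have h4 : (a - b * Real.sqrt M) ^ 2 = a ^ 2 - 2 * a * b * Real.sqrt M + b ^ 2 * M := by
      linear_combination b ^ 2 * h2
    have h5 := sq_nonneg (a - b * Real.sqrt M)
    linarith
  have hpos : ∀ y : ℕ, y < N → 0 ≤ a / Real.sqrt ((y + 1 : ℕ) : ℝ) - b := by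
    intro y hy
    have hs : (0 : ℝ) < Real.sqrt ((y + 1 : ℕ) : ℝ) := Real.sqrt_pos.2 (by positivity)
    rw [sub_nonneg, le_div_iff₀ hs, mul_comm, ← le_div_iff₀ hb]
    refine Real.sqrt_le_iff.2 ⟨by positivity, ?_⟩
    exact (Nat.cast_le.2 hy).trans (Nat.floor_le (by positivity))
  have hneg : ∀ y : ℕ, N ≤ y → a / Real.sqrt ((y + 1 : ℕ) : ℝ) - b ≤ 0 := by
    intro y hy
    have hs : (0 : ℝ) < Real.sqrt ((y + 1 : ℕ) : ℝ) := Real.sqrt_pos.2 (by positivity)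
    rw [sub_nonpos, div_le_iff₀ hs, mul_comm, ← div_le_iff₀ hb]
    refine Real.le_sqrt_of_sq_le ?_
    have h1 := Nat.lt_floor_add_one ((a / b) ^ 2)
    have h2 : (N : ℝ) ≤ y := Nat.cast_le.2 hy
    push_cast
    linarith
  have hN' : ∑ y ∈ Finset.range N, max 0 (a / Real.sqrt ((y + 1 : ℕ) : ℝ) - b) ≤ a ^ 2 / b := by
    refine (Finset.sum_congr rfl fun y hy => ?_).trans_le (hbd N)
    exact max_eq_right (hpos y (Finset.mem_range.1 hy))
  refine le_trans ?_ hN'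
  rw [← Finset.sum_subset (s₁ := Finset.range (min n N)) (s₂ := Finset.range n)
    (Finset.range_mono (min_le_left _ _))]
  · exact Finset.sum_le_sum_of_subset_of_nonneg (Finset.range_mono (min_le_right _ _))
      fun y _ _ => le_max_left _ _
  · intro y hy hy'
    rw [Finset.mem_range] at hy hy'
    refine max_eq_left (hneg y ?_)
    by_contra! h
    exact hy' (lt_min hy h)

/-- The cost that is charged to an observed pair when `y` pairs were certainly observed before. -/
noncomputable def slotCost (κ : ℕ) (a b : ℝ) (y : ℕ) : ℝ :=
  if y = 0 then (κ : ℝ) else max 0 (a / Real.sqrt y - b)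

theorem slotCost_nonneg (κ : ℕ) (a b : ℝ) (y : ℕ) : 0 ≤ slotCost κ a b y := by
  unfold slotCost
  split_ifs
  · positivity
  · exact le_max_left _ _

/-- The potential of the rounds with positive lower confidence bounds. -/
noncomputable def gapPotential (κ : ℕ) (a b : ℝ) (x : ℕ) : ℝ :=
  2 * ∑ z ∈ Finset.range x, slotCost κ a b (z - (κ / 2 - 1))

theorem gapPotential_zero (κ : ℕ) (a b : ℝ) : gapPotential κ a b 0 = 0 := by
  simp [gapPotential]

theorem gapPotential_add_sub (κ : ℕ) (a b : ℝ) (n s : ℕ) :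
    gapPotential κ a b (n + s) - gapPotential κ a b s =
      2 * ∑ z ∈ Finset.range n, slotCost κ a b (s + z - (κ / 2 - 1)) := by
  unfold gapPotential
  rw [add_comm n s, Finset.sum_range_add]
  ring

theorem gapPotential_mono (κ : ℕ) (a b : ℝ) (n s : ℕ) :
    0 ≤ gapPotential κ a b (n + s) - gapPotential κ a b s := by
  rw [gapPotential_add_sub]
  exact mul_nonneg zero_le_two (Finset.sum_nonneg fun z _ => slotCost_nonneg _ _ _ _)

theorem gapPotential_le {κ : ℕ} (hκ : 2 ≤ κ) {a b : ℝ} (ha : 0 ≤ a) (hb : 0 < b) (x : ℕ) :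
    gapPotential κ a b x ≤ (κ : ℝ) ^ 2 + 2 * (a ^ 2 / b) := by
  unfold gapPotential
  set q := κ / 2 - 1 with hq
  have h1 : ∑ z ∈ Finset.range x, slotCost κ a b (z - q) ≤
      ∑ z ∈ Finset.range (q + 1 + x), slotCost κ a b (z - q) :=
    Finset.sum_le_sum_of_subset_of_nonneg (Finset.range_mono (by omega))
      fun z _ _ => slotCost_nonneg _ _ _ _
  rw [Finset.sum_range_add] at h1
  have h2 : ∑ z ∈ Finset.range (q + 1), slotCost κ a b (z - q) = (q + 1 : ℕ) * (κ : ℝ) := by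
    rw [Finset.sum_congr rfl (g := fun _ => (κ : ℝ))]
    · simp
    · intro z hz
      rw [Finset.mem_range] at hz
      rw [slotCost, if_pos (by omega)]
  have h3 : ∑ z ∈ Finset.range x, slotCost κ a b (q + 1 + z - q) ≤ a ^ 2 / b := by
    refine (Finset.sum_congr rfl fun z _ => ?_).trans_le (sum_max_div_sqrt_sub_le ha hb x)
    have : q + 1 + z - q = z + 1 := by omega
    rw [this, slotCost, if_neg (by omega)]
  have h4 : ((q + 1 : ℕ) : ℝ) ≤ (κ : ℝ) / 2 := by
    rw [le_div_iff₀ two_pos]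
    exact_mod_cast (by omega : (q + 1) * 2 ≤ κ)
  have h5 : ((q + 1 : ℕ) : ℝ) * κ ≤ (κ : ℝ) / 2 * κ :=
    mul_le_mul_of_nonneg_right h4 (Nat.cast_nonneg _)
  nlinarith

/-- The potential of the rounds in which a lower confidence bound vanishes. -/
noncomputable def zeroPotential (A c e : ℝ) (x : ℕ) : ℝ :=
  c * min (x : ℝ) A + if A < x then e else 0

theorem zeroPotential_mono (A : ℝ) {c e : ℝ} (hc : 0 ≤ c) (he : 0 ≤ e) (n s : ℕ) :
    0 ≤ zeroPotential A c e (n + s) - zeroPotential A c e s := by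
  unfold zeroPotential
  have h0 : (s : ℝ) ≤ ((n + s : ℕ) : ℝ) := by exact_mod_cast Nat.le_add_left s n
  have h1 : c * min (s : ℝ) A ≤ c * min ((n + s : ℕ) : ℝ) A :=
    mul_le_mul_of_nonneg_left (min_le_min_right _ h0) hc
  split_ifs with h2 h3 h3 <;> linarith

theorem le_zeroPotential_sub {A c e : ℝ} (hc : 0 ≤ c) {n s : ℕ}
    (hs : (s : ℝ) ≤ A) :
    min e (c * n) ≤ zeroPotential A c e (n + s) - zeroPotential A c e s := by
  unfold zeroPotential
  rw [min_eq_left hs, if_neg (not_lt.2 hs)]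
  split_ifs with h2
  · rw [min_eq_right h2.le]
    have : c * s ≤ c * A := mul_le_mul_of_nonneg_left hs hc
    have := min_le_left e (c * n)
    linarith
  · rw [min_eq_left (not_lt.1 h2)]
    have := min_le_right e (c * n)
    push_cast
    linarith

theorem zeroPotential_le {A c e : ℝ} (hc : 0 ≤ c) (he : 0 ≤ e) (x : ℕ) :
    zeroPotential A c e x ≤ c * A + e := by
  unfold zeroPotential
  have := mul_le_mul_of_nonneg_left (min_le_right (x : ℝ) A) hc
  split_ifs <;> linarith

theorem zeroPotential_zero {A c e : ℝ} (hA : 0 ≤ A) : zeroPotential A c e 0 = 0 := by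
  simp [zeroPotential, hA, hA.not_gt]

end Potentials

section LogRegret

variable {m : ℕ} {d : Fin m → ℕ+} {K : ℕ} {kstar : Fin m → ℕ}

/-- All lower confidence bounds are positive in the round that follows the history `h`. -/
def AllPos (h : History d K) : Prop := ∀ i, 0 < lowerConfidenceBound (h.length + 1) h i

/-- The potential that bounds the cost of community `i` in the rounds with positive lower
confidence bounds up to a horizon with logarithm `L`. -/
noncomputable def posPotential (d : Fin m → ℕ+) (K : ℕ) (kstar : Fin m → ℕ) (L : ℝ) (i : Fin m) :
    ℕ → ℝ :=
  gapPotential (K - m + 1) (2 * ((K - m + 1 : ℕ) : ℝ) * Real.sqrt (3 * L / 2))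
    ((invGapMin d K kstar i)⁻¹ / ((K - m : ℕ) : ℝ))

theorem confidenceRadius_le {t : ℕ} {h : History d K} {i : Fin m} {L : ℝ} {y : ℕ}
    (hL : Real.log t ≤ L) (hy : 0 < y) (hle : y ≤ pairCount h i) :
    confidenceRadius t h i ≤ Real.sqrt (3 * L / 2) / Real.sqrt y := by
  have hp : pairCount h i ≠ 0 := by omega
  have hlog := Real.log_natCast_nonneg t
  have hy' : (0 : ℝ) < y := by exact_mod_cast hy
  have hle' : (y : ℝ) ≤ pairCount h i := by exact_mod_cast hle
  rw [confidenceRadius, if_neg hp, ← Real.sqrt_div (by linarith)]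
  refine Real.sqrt_le_sqrt ?_
  rw [div_div]
  exact div_le_div₀ (by linarith) (by linarith) (by positivity) (by linarith)

theorem IsGood.gap_le_posPotential [NeZero m] {L : ℝ} {h : History d K} (hg : IsGood (h.length + 1) h)
    (hopt : IsOptimalAllocation d K kstar) (hm : m < K) {k : Fin m → ℕ}
    (hk : k ∈ (greedyAllocation (lowerConfidenceBound (h.length + 1) h) K).support)
    (hL : Real.log ((h.length + 1 : ℕ) : ℝ) ≤ L) (hpos : AllPos h) :
    gap d K kstar k ≤ ∑ i, (posPotential d K kstar L i (k i / 2 + pairCount h i)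
      - posPotential d K kstar L i (pairCount h i)) := by
  refine (hg.gap_le_of_pos hopt hm hk hpos).trans (Finset.sum_le_sum fun i _ => ?_)
  obtain ⟨hsum, hgr⟩ := greedy_lowerConfidenceBound hk
  have hk1 := hgr.one_le hpos (lowerConfidenceBound_le_one _ h) (hm.le.trans_eq hsum.symm)
  have hsub := sum_sub_one_add k hk1
  have hki : k i ≤ K - m + 1 := by
    have : k i - 1 ≤ ∑ i, (k i - 1) :=
      Finset.single_le_sum (f := fun i => k i - 1) (fun j _ => Nat.zero_le _)
        (Finset.mem_univ i)
    omega
  have hb : 0 ≤ (invGapMin d K kstar i)⁻¹ / ((K - m : ℕ) : ℝ) :=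
    div_nonneg (inv_nonneg.2 (invGapMin_nonneg i)) (Nat.cast_nonneg _)
  unfold posPotential
  rw [gapPotential_add_sub, mul_assoc]
  refine mul_le_mul_of_nonneg_left ?_ zero_le_two
  rw [← nsmul_eq_mul, ← Finset.card_range (k i / 2), ← Finset.sum_const, Finset.card_range]
  refine Finset.sum_le_sum fun z hz => ?_
  rw [Finset.mem_range] at hz
  set y := pairCount h i + z - ((K - m + 1) / 2 - 1) with hy
  have hyle : y ≤ pairCount h i := by omega
  have hκ : (0 : ℝ) ≤ ((K - m + 1 : ℕ) : ℝ) := Nat.cast_nonneg _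
  unfold slotCost
  split_ifs with h0
  · refine max_le hκ ?_
    have := mul_le_mul_of_nonneg_left
      (min_le_left 1 (2 * confidenceRadius (h.length + 1) h i)) hκ
    linarith
  · refine max_le_max le_rfl (sub_le_sub_right ?_ _)
    have h1 := confidenceRadius_le hL (Nat.pos_of_ne_zero h0) hyle
    calc _ ≤ ((K - m + 1 : ℕ) : ℝ) * (2 * confidenceRadius (h.length + 1) h i) :=
          mul_le_mul_of_nonneg_left (min_le_right _ _) hκ
      _ ≤ ((K - m + 1 : ℕ) : ℝ) * (2 * (Real.sqrt (3 * L / 2) / Real.sqrt y)) := by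
          refine mul_le_mul_of_nonneg_left ?_ hκ
          linarith
      _ = _ := by ring

theorem posPotential_mono (L : ℝ) (i : Fin m) (n s : ℕ) :
    0 ≤ posPotential d K kstar L i (n + s) - posPotential d K kstar L i s :=
  gapPotential_mono _ _ _ _ _

theorem posPotential_zero (L : ℝ) (i : Fin m) : posPotential d K kstar L i 0 = 0 :=
  gapPotential_zero _ _ _

theorem posPotential_le {L : ℝ} (hL : 0 ≤ L) (hm : m < K) {i : Fin m}
    (hi : 0 < invGapMin d K kstar i) (x : ℕ) :
    posPotential d K kstar L i x ≤ ((K - m + 1 : ℕ) : ℝ) ^ 2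
      + 12 * ((K - m + 1 : ℕ) : ℝ) ^ 2 * ((K - m : ℕ) : ℝ) * L * invGapMin d K kstar i := by
  have hKm : (0 : ℝ) < ((K - m : ℕ) : ℝ) := by exact_mod_cast Nat.sub_pos_of_lt hm
  refine (gapPotential_le (by omega) (by positivity) (by positivity) x).trans (le_of_eq ?_)
  rw [mul_pow, Real.sq_sqrt (by positivity)]
  field_simp
  ring

/-- The potential that bounds the cost of community `i` in the rounds in which a lower confidence
bound vanishes. -/
noncomputable def vanishPotential (d : Fin m → ℕ+) (K : ℕ) (L : ℝ) (i : Fin m) : ℕ → ℝ :=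
  zeroPotential (6 * L / collisionProb d i ^ 2) (K * collisionProb d i) K

theorem IsGood.gap_le_vanishPotential [NeZero m] {L : ℝ} {h : History d K}
    (hg : IsGood (h.length + 1) h) (hopt : IsOptimalAllocation d K kstar) {k : Fin m → ℕ}
    (hk : k ∈ (greedyAllocation (lowerConfidenceBound (h.length + 1) h) K).support)
    (hL : Real.log ((h.length + 1 : ℕ) : ℝ) ≤ L) (hpos : ¬ AllPos h) :
    gap d K kstar k ≤ ∑ i, (vanishPotential d K L i (k i / 2 + pairCount h i)
      - vanishPotential d K L i (pairCount h i)) := by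
  unfold AllPos at hpos
  push Not at hpos
  obtain ⟨j, hj⟩ := hpos
  refine (hg.gap_le_of_zero hopt hk
    (le_antisymm hj (lowerConfidenceBound_nonneg _ h j))).trans (Finset.sum_le_sum fun i _ => ?_)
  have hp := collisionProb_pos d i
  split_ifs with h0
  · have h1 := hg.pairCount_le_of_eq_zero h0.1
    have h2 : (pairCount h i : ℝ) ≤ 6 * L / collisionProb d i ^ 2 :=
      h1.trans (div_le_div_of_nonneg_right (by linarith) (by positivity))
    refine le_trans (le_of_eq ?_) (le_zeroPotential_sub (by positivity) h2)
    rw [mul_min_of_nonneg _ _ (Nat.cast_nonneg K), mul_one]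
    congr 1
    ring
  · exact zeroPotential_mono _ (by positivity) (by positivity) _ _

theorem vanishPotential_mono (L : ℝ) (i : Fin m) (n s : ℕ) :
    0 ≤ vanishPotential d K L i (n + s) - vanishPotential d K L i s :=
  zeroPotential_mono _ (mul_nonneg (Nat.cast_nonneg _) (collisionProb_pos d i).le)
    (Nat.cast_nonneg _) _ _

theorem vanishPotential_zero {L : ℝ} (hL : 0 ≤ L) (i : Fin m) : vanishPotential d K L i 0 = 0 :=
  zeroPotential_zero (by positivity)

theorem vanishPotential_le {L : ℝ} (i : Fin m) (x : ℕ) :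
    vanishPotential d K L i x ≤ 6 * K * L * (collisionProb d i)⁻¹ + K := by
  have hp := collisionProb_pos d i
  refine (zeroPotential_le (by positivity) (Nat.cast_nonneg _) x).trans (le_of_eq ?_)
  field_simp

theorem log_length_le {h' h : History d K} (hlt : h'.length < h.length) :
    Real.log ((h'.length + 1 : ℕ) : ℝ) ≤ Real.log (h.length : ℝ) :=
  Real.log_le_log (by positivity) (by exact_mod_cast hlt)

/-- The regret of the good rounds with positive lower confidence bounds. -/
theorem pathSum_good_pos_le [NeZero m] (hopt : IsOptimalAllocation d K kstar) (hm : m < K)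
    (hinv : ∀ i, 0 < invGapMin d K kstar i) {h : History d K} (hr : IsReachable h) :
    pathSum (fun k h => gap d K kstar k * ind (IsGood (h.length + 1) h ∧ AllPos h)) h ≤
      ∑ i, (((K - m + 1 : ℕ) : ℝ) ^ 2 + 12 * ((K - m + 1 : ℕ) : ℝ) ^ 2 * ((K - m : ℕ) : ℝ)
        * Real.log h.length * invGapMin d K kstar i) := by
  refine (pathSum_le_of_potential hr (posPotential d K kstar (Real.log h.length))
    fun k h' _ hk hlt => ?_).trans (Finset.sum_le_sum fun i _ => ?_)
  · by_cases hgp : IsGood (h'.length + 1) h' ∧ AllPos h'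
    · rw [ind_of_true hgp, mul_one]
      exact hgp.1.gap_le_posPotential hopt hm hk (log_length_le hlt) hgp.2
    · rw [ind_of_false hgp, mul_zero]
      exact Finset.sum_nonneg fun i _ => posPotential_mono _ i _ _
  · rw [posPotential_zero, sub_zero]
    exact posPotential_le (Real.log_natCast_nonneg _) hm (hinv i) _

/-- The regret of the good rounds in which a lower confidence bound vanishes. -/
theorem pathSum_good_vanish_le [NeZero m] (hopt : IsOptimalAllocation d K kstar) {h : History d K}
    (hr : IsReachable h) :
    pathSum (fun k h => gap d K kstar k * ind (IsGood (h.length + 1) h ∧ ¬ AllPos h)) h ≤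
      ∑ i, (6 * K * Real.log h.length * (collisionProb d i)⁻¹ + K) := by
  refine (pathSum_le_of_potential hr (vanishPotential d K (Real.log h.length))
    fun k h' _ hk hlt => ?_).trans (Finset.sum_le_sum fun i _ => ?_)
  · by_cases hgp : IsGood (h'.length + 1) h' ∧ ¬ AllPos h'
    · rw [ind_of_true hgp, mul_one]
      exact hgp.1.gap_le_vanishPotential hopt hk (log_length_le hlt) hgp.2
    · rw [ind_of_false hgp, mul_zero]
      exact Finset.sum_nonneg fun i _ => vanishPotential_mono _ i _ _
  · rw [vanishPotential_zero (Real.log_natCast_nonneg _), sub_zero]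
    exact vanishPotential_le i _

theorem ind_split (p q : Prop) : ind (p ∧ q) + ind (p ∧ ¬ q) + ind (¬ p) = 1 := by
  by_cases hp : p <;> by_cases hq : q <;> simp [ind, hp, hq]

/-- The decomposition of the gaps of the rounds. -/
theorem pathSum_gap_le [NeZero m] (hm : m < K) {h : History d K} (hr : IsReachable h) :
    pathSum (fun k _ => gap d K kstar k) h ≤
      pathSum (fun k h => gap d K kstar k * ind (IsGood (h.length + 1) h ∧ AllPos h)) h
      + pathSum (fun k h => gap d K kstar k * ind (IsGood (h.length + 1) h ∧ ¬ AllPos h)) h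
      + gapMax d K kstar * pathSum (fun _ h => ind (¬ IsGood (h.length + 1) h)) h := by
  rw [← pathSum_const_mul, ← pathSum_add, ← pathSum_add]
  refine pathSum_mono hr fun k h' _ hk _ => ?_
  have h1 := ind_split (IsGood (h'.length + 1) h') (AllPos h')
  have h2 := mul_le_mul_of_nonneg_right
    (gap_le_gapMax (d := d) (kstar := kstar) hm (greedy_lowerConfidenceBound hk).1)
    (ind_nonneg (¬ IsGood (h'.length + 1) h'))
  have h3 : gap d K kstar k = gap d K kstar k * (ind (IsGood (h'.length + 1) h' ∧ AllPos h')
    + ind (IsGood (h'.length + 1) h' ∧ ¬ AllPos h') + ind (¬ IsGood (h'.length + 1) h')) := by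
    rw [h1, mul_one]
  linarith

theorem sum_inv_sq_le (B N : ℕ) (hB : 0 < B) :
    ∑ n ∈ Finset.range N, 1 / (((B + n : ℕ) : ℝ) + 1) ^ 2 ≤ 1 / (B : ℝ) - 1 / ((B + N : ℕ) : ℝ) := by
  induction N with
  | zero => simp
  | succ N ih =>
    rw [Finset.sum_range_succ]
    have hx : (0 : ℝ) < ((B + N : ℕ) : ℝ) := by positivity
    have h1 : 1 / (((B + N : ℕ) : ℝ) + 1) ^ 2 ≤
        1 / ((B + N : ℕ) : ℝ) - 1 / (((B + N : ℕ) : ℝ) + 1) := by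
      have h2 : 1 / ((B + N : ℕ) : ℝ) - 1 / (((B + N : ℕ) : ℝ) + 1)
          = 1 / (((B + N : ℕ) : ℝ) * (((B + N : ℕ) : ℝ) + 1)) := by
        field_simp
        ring
      rw [h2]
      refine one_div_le_one_div_of_le (by positivity) ?_
      nlinarith
    have h3 : ((B + (N + 1) : ℕ) : ℝ) = ((B + N : ℕ) : ℝ) + 1 := by push_cast; ring
    rw [h3]
    linarith

theorem half_budget_le (hm2 : 2 ≤ m) (hm : m < K) : K / 2 ≤ m * ((K - m + 1) / 2) := by
  obtain ⟨p, hp⟩ : ∃ p, p = (K - m + 1) / 2 := ⟨_, rfl⟩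
  rw [← hp]
  have hp1 : 1 ≤ p := by omega
  obtain ⟨n, rfl⟩ : ∃ n, m = n + 2 := ⟨m - 2, by omega⟩
  obtain ⟨r, rfl⟩ : ∃ r, p = r + 1 := ⟨p - 1, by omega⟩
  have h1 : (n + 2) * (r + 1) = n * r + n + 2 * r + 2 := by ring
  have h2 : 0 ≤ n * r := Nat.zero_le _
  omega

/-- The expected number of rounds with a violated confidence interval. -/
theorem expectation_bad_rounds_le [NeZero m] (hm2 : 2 ≤ m) (hm : m < K) (T : ℕ) :
    expectation (clcbHistory d K T) (pathSum fun _ h => ind (¬ IsGood (h.length + 1) h))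
      ≤ 3 * ((m * ((K - m + 1) / 2) : ℕ) : ℝ) := by
  set B := m * ((K - m + 1) / 2) with hB
  have hB0 : 0 < B := Nat.mul_pos (by omega) (by omega)
  have hB' : (0 : ℝ) < B := by exact_mod_cast hB0
  rw [expectation_pathSum_history]
  set P : ℕ → ℝ := fun n =>
    expectation (clcbHistory d K n) fun h => ind (¬ IsGood (h.length + 1) h) with hP
  have hfin := finite_support_clcbHistory d K
  have hP0 : ∀ n, 0 ≤ P n := fun n => by
    have := expectation_mono (hfin n) (f := fun _ => (0 : ℝ))
      (g := fun h : History d K => ind (¬ IsGood (h.length + 1) h)) fun h _ => ind_nonneg _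
    rwa [expectation_const (hfin n)] at this
  have hP1 : ∀ n, P n ≤ 1 := fun n => by
    have := expectation_mono (hfin n) (g := fun _ => (1 : ℝ))
      (f := fun h : History d K => ind (¬ IsGood (h.length + 1) h)) fun h _ => ind_le_one _
    rwa [expectation_const (hfin n)] at this
  have hP2 : ∀ n, P n ≤ 2 * m * (B : ℝ) * (1 / ((n : ℝ) + 1) ^ 2) := fun n => by
    have h1 : P n = expectation (clcbHistory d K n) (fun h => ind (¬ IsGood (n + 1) h)) :=
      expectation_congr (hfin n) fun h hh => by rw [(clcbHistory_support hh).1]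
    rw [h1, mul_one_div]
    refine (expectation_ind_not_isGood_le d K n).trans
      (div_le_div_of_nonneg_right ?_ (by positivity))
    refine mul_le_mul_of_nonneg_left ?_ (by positivity)
    exact_mod_cast half_budget_le hm2 hm
  calc ∑ n ∈ Finset.range T, P n ≤ ∑ n ∈ Finset.range (B + T), P n :=
        Finset.sum_le_sum_of_subset_of_nonneg (Finset.range_mono (by omega)) fun n _ _ => hP0 n
    _ = ∑ n ∈ Finset.range B, P n + ∑ n ∈ Finset.range T, P (B + n) := Finset.sum_range_add _ _ _
    _ ≤ ∑ n ∈ Finset.range B, (1 : ℝ)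
        + ∑ n ∈ Finset.range T, 2 * m * (B : ℝ) * (1 / (((B + n : ℕ) : ℝ) + 1) ^ 2) :=
        add_le_add (Finset.sum_le_sum fun n _ => hP1 n) (Finset.sum_le_sum fun n _ => hP2 _)
    _ ≤ B + 2 * m * (B : ℝ) * (1 / (B : ℝ)) := by
        rw [← Finset.mul_sum]
        refine add_le_add (by simp) (mul_le_mul_of_nonneg_left ?_ (by positivity))
        refine (sum_inv_sq_le B T hB0).trans ?_
        have : (0 : ℝ) ≤ 1 / ((B + T : ℕ) : ℝ) := by positivity
        linarith
    _ = B + 2 * m := by field_simp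
    _ ≤ 3 * B := by
        have : m ≤ B := Nat.le_mul_of_pos_right m (by omega)
        have : (m : ℝ) ≤ B := by exact_mod_cast this
        linarith

theorem three_mul_le_pi_sq_mul :
    3 * ((m * ((K - m + 1) / 2) : ℕ) : ℝ) * gapMax d K kstar ≤
      (((K - m + 1) / 2 : ℕ) : ℝ) * Real.pi ^ 2 / 3 * (m : ℝ) * gapMax d K kstar := by
  refine mul_le_mul_of_nonneg_right ?_ gapMax_nonneg
  have h1 : (9 : ℝ) ≤ Real.pi ^ 2 := by nlinarith [Real.pi_gt_three]
  have h2 : (0 : ℝ) ≤ (((K - m + 1) / 2 : ℕ) : ℝ) * m := by positivity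
  rw [Nat.cast_mul]
  nlinarith

theorem invGapMin_mul_ge [NeZero m] (hopt : IsOptimalAllocation d K kstar) (hm2 : 2 ≤ m) (hm : m < K)
    (i : Fin m) :
    0 < invGapMin d K kstar i ∧
      (collisionProb d i)⁻¹ ≤ ((K - m + 1 : ℕ) : ℝ) * invGapMin d K kstar i := by
  have : Nontrivial (Fin m) := Fin.nontrivial_iff_two_le.2 hm2
  obtain ⟨j, hj⟩ := exists_ne i
  have h1 := inv_le_invGapMin hopt hm hj.symm
  have hκ : (0 : ℝ) < ((K - m + 1 : ℕ) : ℝ) := by positivity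
  have hp := collisionProb_pos d i
  refine ⟨lt_of_lt_of_le (by positivity) h1, ?_⟩
  rw [mul_inv] at h1
  have := mul_le_mul_of_nonneg_left h1 hκ.le
  rwa [mul_inv_cancel_left₀ hκ.ne'] at this

theorem regret_nonpos_of_subsingleton [NeZero m] [Subsingleton (Fin m)]
    (hopt : IsOptimalAllocation d K kstar) (T : ℕ) : regret d K kstar T ≤ 0 := by
  rw [regret_eq, ← expectation_const (finite_support_clcbHistory d K T) 0]
  refine expectation_mono (finite_support_clcbHistory d K T) fun h hh => ?_
  have h1 : pathSum (fun k _ => gap d K kstar k) h ≤ pathSum (fun _ _ => (0 : ℝ) * 0) h :=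
    pathSum_mono (clcbHistory_support hh).2 fun k h' _ hk _ => by
      rw [gap_eq_zero_of_subsingleton hopt (greedy_lowerConfidenceBound hk).1, mul_zero]
  rwa [pathSum_const_mul, zero_mul] at h1

theorem regret_one_le [NeZero m] (hm : m < K) (hm2 : 2 ≤ m) :
    regret d K kstar 1 ≤ 3 * ((m * ((K - m + 1) / 2) : ℕ) : ℝ) * gapMax d K kstar := by
  have hfin := finite_support_clcbHistory d K 1
  rw [regret_eq]
  have h1 : expectation (clcbHistory d K 1) (pathSum fun k _ => gap d K kstar k) ≤
      gapMax d K kstar := by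
    rw [← expectation_const hfin (gapMax d K kstar)]
    refine expectation_mono hfin fun h hh => ?_
    obtain ⟨hl, hr⟩ := clcbHistory_support hh
    obtain ⟨r, rfl⟩ := List.length_eq_one_iff.1 hl
    simp only [pathSum, add_zero]
    exact gap_le_gapMax hm (greedy_lowerConfidenceBound hr.1).1
  have h2 : (1 : ℝ) ≤ ((m * ((K - m + 1) / 2) : ℕ) : ℝ) := by
    exact_mod_cast Nat.mul_pos (by omega : 0 < m) (by omega : 0 < (K - m + 1) / 2)
  have h3 := gapMax_nonneg (d := d) (K := K) (kstar := kstar)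
  nlinarith

theorem regret_le_of_two_le [NeZero m] (hopt : IsOptimalAllocation d K kstar) (hm2 : 2 ≤ m) (hm : m < K)
    (T : ℕ) :
    regret d K kstar T ≤
      ∑ i, (((K - m + 1 : ℕ) : ℝ) ^ 2 + 12 * ((K - m + 1 : ℕ) : ℝ) ^ 2 * ((K - m : ℕ) : ℝ)
        * Real.log T * invGapMin d K kstar i)
      + ∑ i, (6 * K * Real.log T * (collisionProb d i)⁻¹ + K)
      + gapMax d K kstar * (3 * ((m * ((K - m + 1) / 2) : ℕ) : ℝ)) := by
  have hfin := finite_support_clcbHistory d K T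
  rw [regret_eq]
  refine le_trans ?_ (add_le_add le_rfl (mul_le_mul_of_nonneg_left
    (expectation_bad_rounds_le (d := d) hm2 hm T) gapMax_nonneg))
  rw [← expectation_const_mul, ← expectation_const hfin (∑ i, _ + ∑ i, _), ← expectation_add hfin]
  refine expectation_mono hfin fun h hh => ?_
  obtain ⟨hl, hr⟩ := clcbHistory_support hh
  refine (pathSum_gap_le hm hr).trans (add_le_add (add_le_add ?_ ?_) le_rfl)
  · have := pathSum_good_pos_le hopt hm (fun i => (invGapMin_mul_ge hopt hm2 hm i).1) hr
    rwa [hl] at this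
  · have := pathSum_good_vanish_le hopt hr
    rwa [hl] at this

theorem regret_le_log [NeZero m] (hopt : IsOptimalAllocation d K kstar) (hm : m < K) {T : ℕ} (hT : 1 ≤ T) :
    regret d K kstar T ≤
      (∑ i, 48 * ((K - m + 1).choose 2 : ℝ) * (K : ℝ) * Real.log T * invGapMin d K kstar i)
        + 2 * ((K - m + 1).choose 2 : ℝ) * (m : ℝ)
        + (((K - m + 1) / 2 : ℕ) : ℝ) * Real.pi ^ 2 / 3 * (m : ℝ) * gapMax d K kstar := by
  have hlog := Real.log_natCast_nonneg T
  have hterm : ∀ i, 0 ≤ 48 * ((K - m + 1).choose 2 : ℝ) * (K : ℝ) * Real.log T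
      * invGapMin d K kstar i := fun i => mul_nonneg (by positivity) (invGapMin_nonneg i)
  have hsum := Finset.sum_nonneg fun i (_ : i ∈ Finset.univ) => hterm i
  have hB := three_mul_le_pi_sq_mul (d := d) (K := K) (kstar := kstar)
  have hG := gapMax_nonneg (d := d) (K := K) (kstar := kstar)
  have hc : (0 : ℝ) ≤ 2 * ((K - m + 1).choose 2 : ℝ) * (m : ℝ) := by positivity
  have hB0 : 0 ≤ 3 * ((m * ((K - m + 1) / 2) : ℕ) : ℝ) * gapMax d K kstar :=
    mul_nonneg (by positivity) hG
  rcases Nat.lt_or_ge m 2 with hm2 | hm2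
  · have : Subsingleton (Fin m) := Fin.subsingleton_iff_le_one.2 (by omega)
    have := regret_nonpos_of_subsingleton hopt T
    linarith
  rcases hT.eq_or_lt with rfl | hT2
  · exact ((regret_one_le hm hm2).trans hB).trans (le_add_of_nonneg_left (add_nonneg hsum hc))
  have hmain := regret_le_of_two_le hopt hm2 hm T
  have hL : (1 : ℝ) / 2 ≤ Real.log T := by
    have h1 : Real.log 2 ≤ Real.log T :=
      Real.log_le_log two_pos (by exact_mod_cast hT2)
    have := Real.log_two_gt_d9
    linarith
  have hconst : 2 * ((K - m + 1).choose 2 : ℝ) * (m : ℝ)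
      = ∑ _i : Fin m, 2 * ((K - m + 1).choose 2 : ℝ) := by
    simp
    ring
  rw [hconst, ← Finset.sum_add_distrib]
  rw [← Finset.sum_add_distrib] at hmain
  refine hmain.trans (add_le_add (Finset.sum_le_sum fun i _ => ?_) (by linarith))
  obtain ⟨hv, hw⟩ := invGapMin_mul_ge hopt hm2 hm i
  set v := invGapMin d K kstar i
  set w := (collisionProb d i)⁻¹
  have hw1 : 1 ≤ w := (one_le_inv₀ (collisionProb_pos d i)).2 (collisionProb_le_one d i)
  set L := Real.log T
  rw [Nat.cast_choose_two]
  have hκK : ((K - m + 1 : ℕ) : ℝ) ≤ K := by exact_mod_cast (by omega : K - m + 1 ≤ K)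
  have hκ2 : (2 : ℝ) ≤ ((K - m + 1 : ℕ) : ℝ) := by exact_mod_cast (by omega : 2 ≤ K - m + 1)
  have hκ1 : ((K - m : ℕ) : ℝ) = ((K - m + 1 : ℕ) : ℝ) - 1 := by push_cast; ring
  rw [hκ1]
  set κ := ((K - m + 1 : ℕ) : ℝ)
  set Q := (K : ℝ)
  have hQ : 0 ≤ Q := by linarith
  have hLv : L ≤ L * v * κ := by nlinarith
  have h6 : 6 * Q * L * w ≤ 6 * Q * κ * L * v := by
    have := mul_le_mul_of_nonneg_left hw (show 0 ≤ 6 * Q * L by positivity)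
    linarith
  have hbr : 6 * Q ≤ 24 * (κ - 1) * Q - 12 * κ * (κ - 1) - 6 * Q := by nlinarith
  have hfin : 3 * Q ≤ L * v * κ * (24 * (κ - 1) * Q - 12 * κ * (κ - 1) - 6 * Q) := by
    calc 3 * Q ≤ L * (6 * Q) := by nlinarith
      _ ≤ L * v * κ * (6 * Q) := mul_le_mul_of_nonneg_right hLv (by positivity)
      _ ≤ _ := mul_le_mul_of_nonneg_left hbr (by positivity)
  nlinarith

end LogRegret

section Windows

variable {m : ℕ} {d : Fin m → ℕ+} {K : ℕ} {kstar : Fin m → ℕ}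

theorem one_le_min_sub_min {A : ℝ} {n s : ℕ} (hn : 1 < n) (hs : (s : ℝ) ≤ A) :
    1 ≤ min ((n / 2 + s : ℕ) : ℝ) (A + 1) - min (s : ℝ) (A + 1) := by
  have h1 : (1 : ℝ) ≤ ((n / 2 : ℕ) : ℝ) := by exact_mod_cast (by omega : 1 ≤ n / 2)
  rw [min_eq_left (by linarith : (s : ℝ) ≤ A + 1), le_sub_iff_add_le, le_min_iff, Nat.cast_add]
  constructor <;> linarith

theorem min_sub_min_nonneg (A : ℝ) (n s : ℕ) :
    0 ≤ min ((n / 2 + s : ℕ) : ℝ) (A + 1) - min (s : ℝ) (A + 1) :=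
  sub_nonneg.2 (min_le_min_right _ (by exact_mod_cast Nat.le_add_left s (n / 2)))

/-- Among many consecutive rounds there is one that explores only well-explored communities more
than once. -/
theorem exists_round_of_window {A : ℝ} (hA0 : 0 ≤ A) {n : ℕ} (h : History d K) (hn : n ≤ h.length)
    (hA : (m : ℝ) * (A + 1) < n) :
    ∃ (r : (Fin m → ℕ) × Realization d K) (h' : History d K), r :: h' <:+ h ∧
      h.length ≤ h'.length + n ∧ ∀ j, 1 < r.1 j → A < pairCount h' j := by
  by_contra! hcon
  have key : ∀ (g : History d K) (l : ℕ), g <:+ h → l ≤ g.length → h.length ≤ g.length + (n - l) →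
      l ≤ n → (l : ℝ) ≤ ∑ j, (min (pairCount g j : ℝ) (A + 1) - min ((0 : ℕ) : ℝ) (A + 1)) := by
    intro g
    induction g with
    | nil =>
      intro l _ hl _ _
      have : l = 0 := by simpa using hl
      subst this
      simp [pairCount_nil]
    | cons r g ih =>
      intro l hs hl hlen hln
      rcases Nat.eq_zero_or_pos l with rfl | hl0
      · rw [Nat.cast_zero]
        exact Finset.sum_nonneg fun j _ =>
          sub_nonneg.2 (min_le_min_right _ (by exact_mod_cast Nat.zero_le _))
      obtain ⟨l, rfl⟩ := Nat.exists_eq_succ_of_ne_zero hl0.ne'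
      rw [List.length_cons] at hl hlen
      have h1 := ih l ((List.suffix_cons r g).trans hs) (by omega) (by omega) (by omega)
      obtain ⟨j, hj, hjA⟩ := hcon r g hs (by omega)
      have h2 : (1 : ℝ) ≤ ∑ j, (min (pairCount (r :: g) j : ℝ) (A + 1)
          - min (pairCount g j : ℝ) (A + 1)) := by
        obtain ⟨k, φ⟩ := r
        simp_rw [pairCount_cons]
        exact (one_le_min_sub_min hj hjA).trans
          (Finset.single_le_sum (f := fun j => min ((k j / 2 + pairCount g j : ℕ) : ℝ) (A + 1)
          - min (pairCount g j : ℝ) (A + 1))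
            (fun j _ => min_sub_min_nonneg A _ _) (Finset.mem_univ j))
      rw [Nat.cast_succ]
      rw [Finset.sum_sub_distrib] at h1 h2 ⊢
      linarith
  have h1 := key h n List.suffix_rfl hn (by omega) le_rfl
  have h2 : ∑ j, (min (pairCount h j : ℝ) (A + 1) - min ((0 : ℕ) : ℝ) (A + 1)) ≤ ∑ _j : Fin m, (A + 1) := by
    refine Finset.sum_le_sum fun j _ => ?_
    rw [Nat.cast_zero, min_eq_left (by linarith : (0 : ℝ) ≤ A + 1), sub_zero]
    exact min_le_right _ _
  rw [Finset.sum_const, Finset.card_univ, Fintype.card_fin, nsmul_eq_mul] at h2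
  linarith

theorem pairCount_mono {h h' : History d K} (hs : h' <:+ h) (i : Fin m) :
    pairCount h' i ≤ pairCount h i := by
  obtain ⟨l, rfl⟩ := hs
  simp [pairCount]

/-- At some time, an empirical mean of at least `w` observations deviates by `η`. -/
def Deviates (η w : ℝ) (h : History d K) : Prop :=
  ∃ h', h' <:+ h ∧ ∃ i, w ≤ pairCount h' i ∧ η ≤ |empiricalMean h' i - collisionProb d i|

theorem le_lowerConfidenceBound_of_not_deviates {η w L : ℝ} (hη : 0 < η) {h : History d K}
    (hdev : ¬ Deviates η w h) {t : ℕ} (ht : Real.log t ≤ L) {j : Fin m}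
    (hj : 8 * η ≤ collisionProb d j) (hw : w ≤ 3 * L / (8 * η ^ 2))
    (hp : 3 * L / (8 * η ^ 2) < pairCount h j) : 5 * η ≤ lowerConfidenceBound t h j := by
  have h1 : |empiricalMean h j - collisionProb d j| < η := by
    by_contra! hcon
    exact hdev ⟨h, List.suffix_rfl, j, by linarith, hcon⟩
  have h2 : confidenceRadius t h j < 2 * η := by
    by_contra! hcon
    have h3 := pairCount_le_of_le_confidenceRadius (by linarith) hcon
    have h4 : 3 * Real.log t / (2 * (2 * η) ^ 2) ≤ 3 * L / (8 * η ^ 2) := by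
      have : 2 * (2 * η) ^ 2 = 8 * η ^ 2 := by ring
      rw [this]
      exact div_le_div_of_nonneg_right (by linarith) (by positivity)
    linarith
  have h3 := (abs_lt.1 h1).1
  exact le_max_of_le_right (by linarith)

variable [NeZero m]

theorem IsReachable.of_suffix {h h' : History d K} (hr : IsReachable h) (hs : h' <:+ h) :
    IsReachable h' := by
  induction h with
  | nil => rwa [List.suffix_nil.1 hs]
  | cons r h ih =>
    rcases List.suffix_cons_iff.1 hs with rfl | h2
    · exact hr
    · exact ih hr.2 h2

/-- The number of rounds that explore a rarely explored community more than once. -/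
theorem pathSum_ind_rare_le {A : ℝ} (hA : 0 ≤ A) {h : History d K} (hr : IsReachable h) :
    pathSum (fun k h => ind (∃ i, 1 < k i ∧ (pairCount h i : ℝ) ≤ A)) h ≤ m * (A + 1) := by
  refine (pathSum_le_of_potential hr (fun _ x => min (x : ℝ) (A + 1))
    fun k h' _ _ _ => ?_).trans ?_
  · refine ind_le_of_imp (Finset.sum_nonneg fun i _ => min_sub_min_nonneg A _ _) ?_
    rintro ⟨i, hi, hiA⟩
    exact (one_le_min_sub_min hi hiA).trans (Finset.single_le_sum
      (f := fun j => min ((k j / 2 + pairCount h' j : ℕ) : ℝ) (A + 1)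
          - min (pairCount h' j : ℝ) (A + 1))
      (fun j _ => min_sub_min_nonneg A _ _) (Finset.mem_univ i))
  · have : ∑ i, (min (pairCount h i : ℝ) (A + 1) - min ((0 : ℕ) : ℝ) (A + 1))
        ≤ ∑ _i : Fin m, (A + 1) := by
      refine Finset.sum_le_sum fun j _ => ?_
      rw [Nat.cast_zero, min_eq_left (by linarith : (0 : ℝ) ≤ A + 1), sub_zero]
      exact min_le_right _ _
    rwa [Finset.sum_const, Finset.card_univ, Fintype.card_fin, nsmul_eq_mul] at this

theorem expectation_ind_deviates_le {η w : ℝ} (hη : 0 ≤ η) (hw : 0 < w) (T : ℕ) :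
    expectation (clcbHistory d K T) (fun h => ind (Deviates η w h))
      ≤ 2 * m * Real.exp (-(2 * η ^ 2 * w)) := by
  have hfin := finite_support_clcbHistory d K T
  set a := Real.exp (2 * η ^ 2 * w) with ha
  let E : Fin m → ℝ → History d K → Prop := fun i l h =>
    ∃ h', h' <:+ h ∧ a ≤ expProcess d K i l h'
  have hpt : ∀ h ∈ (clcbHistory d K T).support, ind (Deviates η w h) ≤
      ∑ i, (ind (E i (4 * η) h) + ind (E i (-(4 * η)) h)) := by
    intro h _
    refine ind_le_of_imp (Finset.sum_nonneg fun i _ => add_nonneg (ind_nonneg _) (ind_nonneg _)) ?_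
    rintro ⟨h', hs, i, hi, hdev⟩
    refine le_trans ?_ (Finset.single_le_sum
      (f := fun i => ind (E i (4 * η) h) + ind (E i (-(4 * η)) h))
      (fun i _ => add_nonneg (ind_nonneg _) (ind_nonneg _)) (Finset.mem_univ i))
    have hp : pairCount h' i ≠ 0 := by
      intro h0
      rw [h0, Nat.cast_zero] at hi
      linarith
    have hexp : a ≤ Real.exp (2 * η ^ 2 * pairCount h' i) :=
      Real.exp_le_exp.2 (mul_le_mul_of_nonneg_left hi (by positivity))
    rcases le_abs.1 hdev with h1 | h1
    · rw [ind_of_true (p := E i (4 * η) h)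
        ⟨h', hs, hexp.trans (le_expProcess_of_deviation hη hp h1)⟩]
      linarith [ind_nonneg (E i (-(4 * η)) h)]
    · rw [neg_sub] at h1
      rw [ind_of_true (p := E i (-(4 * η)) h)
        ⟨h', hs, hexp.trans (le_expProcess_of_neg_deviation hη hp h1)⟩]
      linarith [ind_nonneg (E i (4 * η) h)]
  have hE : ∀ i l, expectation (clcbHistory d K T) (fun h => ind (E i l h))
      ≤ Real.exp (-(2 * η ^ 2 * w)) := by
    intro i l
    refine (expectation_ind_exists_suffix_le (expProcess d K i l) (expProcess_nonneg i l)
      (fun h k hk => expectation_expProcess_cons_le i l h (le_of_sum_eq hk i))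
      (Real.exp_pos _) T).trans (le_of_eq ?_)
    rw [Real.exp_neg]
    simp [expProcess, collisionCount_nil, pairCount_nil]
  refine (expectation_mono hfin hpt).trans ?_
  rw [expectation_sum hfin]
  simp_rw [expectation_add hfin]
  calc _ ≤ ∑ _i : Fin m, 2 * Real.exp (-(2 * η ^ 2 * w)) :=
        Finset.sum_le_sum fun i _ => by linarith [hE i (4 * η), hE i (-(4 * η))]
    _ = _ := by
        simp
        ring

/-- A lower confidence bound does not vanish late: in a window before that time, the community
was explored only once in a round that explored a well-known community more than once. -/
theorem lowerConfidenceBound_pos_of_window {η w L : ℝ} (hη : 0 < η)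
    (hp : ∀ j, 8 * η ≤ collisionProb d j) (hm : m < K) {h : History d K} (hr : IsReachable h)
    (hdev : ¬ Deviates η w h) (hL : Real.log ((h.length + 1 : ℕ) : ℝ) ≤ L) (hL0 : 0 ≤ L)
    (hw : w ≤ 3 * L / (8 * η ^ 2)) {n : ℕ} (hn : n ≤ h.length)
    (hA : (m : ℝ) * (3 * L / (8 * η ^ 2) + 1) < n)
    (hlog : ∀ u : ℕ, h.length ≤ u + n → w ≤ 3 / 2 * Real.log ((u + 1 : ℕ) : ℝ) ∧
      Real.log ((h.length + 1 : ℕ) : ℝ) ≤ (1 + η ^ 2) * Real.log ((u + 1 : ℕ) : ℝ)) :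
    AllPos h := by
  intro i
  by_contra! hzero
  replace hzero := le_antisymm hzero (lowerConfidenceBound_nonneg _ h i)
  set A := 3 * L / (8 * η ^ 2) with hAdef
  obtain ⟨r, g, hs, hlen, hwell⟩ := exists_round_of_window (by positivity) h hn hA
  have hgs : g <:+ h := (List.suffix_cons r g).trans hs
  obtain ⟨hk, hrg⟩ := hr.of_suffix hs
  have hdevg : ¬ Deviates η w g := fun ⟨h', h1, h2⟩ => hdev ⟨h', h1.trans hgs, h2⟩
  obtain ⟨hlw, hlr⟩ := hlog g.length hlen
  have hgl : Real.log ((g.length + 1 : ℕ) : ℝ) ≤ L :=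
    le_trans (Real.log_le_log (by positivity)
      (by exact_mod_cast Nat.succ_le_succ hgs.length_le)) hL
  obtain ⟨hsum, hgr⟩ := greedy_lowerConfidenceBound hk
  obtain ⟨j, hj⟩ := exists_one_lt (hm.trans_eq hsum.symm)
  have hlj := le_lowerConfidenceBound_of_not_deviates hη hdevg hgl (hp j) hw (hwell j hj)
  have hpos : ∀ l, 0 < lowerConfidenceBound (g.length + 1) g l := by
    intro l
    by_contra! hl
    have := hgr.le_one_of_zero (i := j) (by linarith) (lowerConfidenceBound_le_one _ g j)
      (le_antisymm hl (lowerConfidenceBound_nonneg _ g l))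
    omega
  have hki : r.1 i = 1 := by
    have h1 := hgr.one_le hpos (lowerConfidenceBound_le_one _ g) (hm.le.trans_eq hsum.symm) i
    by_contra hne
    have h2 := hwell i (by omega)
    have h3 : (pairCount g i : ℝ) ≤ pairCount h i := by exact_mod_cast pairCount_mono hgs i
    have := le_lowerConfidenceBound_of_not_deviates hη hdev hL (hp i) hw (h2.trans_le h3)
    linarith
  have hli : 5 * η ≤ lowerConfidenceBound (g.length + 1) g i :=
    hlj.trans (hgr.le_of_one_lt (lowerConfidenceBound_nonneg _ g)
      (lowerConfidenceBound_le_one _ g) hki hj)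
  have hli' : 5 * η ≤ empiricalMean g i - confidenceRadius (g.length + 1) g i := by
    rcases le_max_iff.1 hli with h1 | h1
    · linarith
    · exact h1
  have hpg : pairCount g i ≠ 0 := by
    intro h0
    simp only [empiricalMean, confidenceRadius, h0, if_true] at hli'
    linarith
  have hpg' : (0 : ℝ) < pairCount g i := by positivity
  have hle : (pairCount g i : ℝ) ≤ pairCount h i := by exact_mod_cast pairCount_mono hgs i
  have hph' : (0 : ℝ) < pairCount h i := by linarith
  have hph : pairCount h i ≠ 0 := by exact_mod_cast hph'.ne'
  have hsqg := confidenceRadius_sq (t := g.length + 1) hpg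
  have hsqh := confidenceRadius_sq (t := h.length + 1) hph
  have hρ0 := confidenceRadius_nonneg (g.length + 1) g i
  have hwg : w ≤ pairCount g i := by
    have h1 : confidenceRadius (g.length + 1) g i ≤ 1 := by
      linarith [empiricalMean_le_one g i]
    have h2 : confidenceRadius (g.length + 1) g i ^ 2 ≤ 1 := pow_le_one₀ hρ0 h1
    rw [hsqg, div_le_one (by positivity)] at h2
    linarith
  have hmg : empiricalMean g i - collisionProb d i < η := by
    by_contra! hcon
    exact hdevg ⟨g, List.suffix_rfl, i, hwg, hcon.trans (le_abs_self _)⟩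
  have hmh : collisionProb d i - empiricalMean h i < η := by
    by_contra! hcon
    refine hdev ⟨h, List.suffix_rfl, i, hwg.trans hle, hcon.trans ?_⟩
    rw [abs_sub_comm]
    exact le_abs_self _
  have hzh : empiricalMean h i ≤ confidenceRadius (h.length + 1) h i := by
    have : empiricalMean h i - confidenceRadius (h.length + 1) h i ≤ 0 :=
      (le_max_right _ _).trans_eq hzero
    linarith
  have hcmp : confidenceRadius (h.length + 1) h i ^ 2
      ≤ (1 + η ^ 2) * confidenceRadius (g.length + 1) g i ^ 2 := by
    rw [hsqg, hsqh, ← mul_div_assoc]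
    have := Real.log_natCast_nonneg (g.length + 1)
    refine div_le_div₀ (by positivity) ?_ (by positivity) (by linarith)
    linarith
  have hpi := hp i
  have hpi1 := collisionProb_le_one d i
  have h1 : (collisionProb d i - η) ^ 2 ≤ confidenceRadius (h.length + 1) h i ^ 2 :=
    pow_le_pow_left₀ (by linarith) (by linarith) 2
  have h2 : confidenceRadius (g.length + 1) g i ^ 2 ≤ (collisionProb d i - 4 * η) ^ 2 :=
    pow_le_pow_left₀ hρ0 (by linarith) 2
  have h3 : (collisionProb d i - 4 * η) ^ 2 ≤ 1 := pow_le_one₀ (by linarith) (by linarith)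
  have hη2 : 0 < η ^ 2 := by positivity
  have h4 : (1 + η ^ 2) * confidenceRadius (g.length + 1) g i ^ 2
      ≤ (collisionProb d i - 4 * η) ^ 2 + η ^ 2 := by
    nlinarith
  nlinarith

end Windows

section Asymptotics

variable {m : ℕ} [NeZero m] {d : Fin m → ℕ+} {K : ℕ} {kstar : Fin m → ℕ}

theorem IsGood.exists_rare {η L : ℝ} (hη : 0 < η) (hp : ∀ j, 8 * η ≤ collisionProb d j)
    (hm : m < K) {h : History d K} (hg : IsGood (h.length + 1) h)
    (hL : Real.log ((h.length + 1 : ℕ) : ℝ) ≤ L) (hpos : ¬ AllPos h) {k : Fin m → ℕ}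
    (hk : k ∈ (greedyAllocation (lowerConfidenceBound (h.length + 1) h) K).support) :
    ∃ i, 1 < k i ∧ (pairCount h i : ℝ) ≤ 6 / (8 * η) ^ 2 * L := by
  unfold AllPos at hpos
  push Not at hpos
  obtain ⟨j, hj⟩ := hpos
  obtain ⟨hsum, hgr⟩ := greedy_lowerConfidenceBound hk
  obtain ⟨i, hi⟩ := exists_one_lt (hm.trans_eq hsum.symm)
  refine ⟨i, hi, ?_⟩
  have hz : lowerConfidenceBound (h.length + 1) h i = 0 := by
    by_contra hne
    have := hgr.le_one_of_zero (lt_of_le_of_ne (lowerConfidenceBound_nonneg _ h i)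
      (Ne.symm hne)) (lowerConfidenceBound_le_one _ h i)
      (le_antisymm hj (lowerConfidenceBound_nonneg _ h j))
    omega
  refine (hg.pairCount_le_of_eq_zero hz).trans ?_
  rw [div_mul_eq_mul_div]
  have hlog := Real.log_natCast_nonneg (h.length + 1)
  exact div_le_div₀ (by linarith) (by linarith) (by positivity)
    (pow_le_pow_left₀ (by linarith) (hp i) 2)

/-- The number of good rounds in which a lower confidence bound vanishes. -/
theorem pathSum_ind_vanish_le {η : ℝ} (hη : 0 < η) (hp : ∀ j, 8 * η ≤ collisionProb d j)
    (hm : m < K) {h : History d K} (hr : IsReachable h) {L : ℝ} (hL : 0 ≤ L)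
    (hvan : ∀ h' : History d K, h' <:+ h → h'.length < h.length → ¬ AllPos h' →
      Real.log ((h'.length + 1 : ℕ) : ℝ) ≤ L) :
    pathSum (fun _ h => ind (IsGood (h.length + 1) h ∧ ¬ AllPos h)) h ≤
      m * (6 / (8 * η) ^ 2 * L + 1) := by
  refine le_trans (pathSum_mono_of_suffix hr fun k h' _ hk hlt hs => ?_)
    (pathSum_ind_rare_le (A := 6 / (8 * η) ^ 2 * L) (by positivity) hr)
  refine ind_le_of_imp (ind_nonneg _) ?_
  rintro ⟨hg, hpos⟩
  exact (ind_of_true (hg.exists_rare hη hp hm (hvan h' hs hlt hpos) hpos hk)).ge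

theorem allPos_of_not_deviates {η x : ℝ} (hη : 0 < η) (hp : ∀ j, 8 * η ≤ collisionProb d j)
    (hm : m < K) (hx3 : 3 ≤ x) (hxη : 1 + 1 / η ^ 2 ≤ x)
    (hexp : 2 * ((m : ℝ) * (3 * x ^ 2 / (8 * η ^ 2) + 1) + 1) ≤ Real.exp x)
    {h : History d K} (hr : IsReachable h) (hdev : ¬ Deviates η x h)
    (hL : Real.log ((h.length + 1 : ℕ) : ℝ) ≤ x ^ 2)
    (hlate : x < Real.log ((h.length + 1 : ℕ) : ℝ)) : AllPos h := by
  have hlen : Real.exp x < ((h.length + 1 : ℕ) : ℝ) :=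
    (Real.lt_log_iff_exp_lt (by positivity)).1 hlate
  set n := ⌊(m : ℝ) * (3 * x ^ 2 / (8 * η ^ 2) + 1)⌋₊ + 1 with hn
  have h1 : (m : ℝ) * (3 * x ^ 2 / (8 * η ^ 2) + 1) < n := by
    rw [hn]
    push_cast
    exact Nat.lt_floor_add_one _
  have h2 : (n : ℝ) ≤ (m : ℝ) * (3 * x ^ 2 / (8 * η ^ 2) + 1) + 1 := by
    rw [hn]
    push_cast
    linarith [Nat.floor_le (show 0 ≤ (m : ℝ) * (3 * x ^ 2 / (8 * η ^ 2) + 1) by positivity)]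
  have h3 : 2 * n < h.length + 1 := by
    have : ((2 * n : ℕ) : ℝ) < ((h.length + 1 : ℕ) : ℝ) := by
      rw [Nat.cast_mul, Nat.cast_two]
      linarith
    exact_mod_cast this
  have hη1 : 8 * η ≤ 1 := (hp 0).trans (collisionProb_le_one d 0)
  refine lowerConfidenceBound_pos_of_window hη hp hm hr hdev hL (by positivity) ?_
    (by omega : n ≤ h.length) h1 fun u hu => ?_
  · rw [le_div_iff₀ (by positivity)]
    have : 8 * η ^ 2 ≤ 1 := by nlinarith
    nlinarith
  · have h4 : Real.log ((h.length + 1 : ℕ) : ℝ) ≤ Real.log 2 + Real.log ((u + 1 : ℕ) : ℝ) := by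
      rw [← Real.log_mul two_ne_zero (by positivity)]
      refine Real.log_le_log (by positivity) ?_
      exact_mod_cast (by omega : h.length + 1 ≤ 2 * (u + 1))
    have h5 := Real.log_two_lt_d9
    have h6 : 1 / η ^ 2 ≤ Real.log ((u + 1 : ℕ) : ℝ) := by linarith
    rw [div_le_iff₀ (by positivity)] at h6
    constructor
    · linarith
    · linarith

theorem expectation_vanish_le {η x : ℝ} (hη : 0 < η) (hp : ∀ j, 8 * η ≤ collisionProb d j)
    (hm : m < K) (hx3 : 3 ≤ x) (hxη : 1 + 1 / η ^ 2 ≤ x)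
    (hexp : 2 * ((m : ℝ) * (3 * x ^ 2 / (8 * η ^ 2) + 1) + 1) ≤ Real.exp x)
    {T : ℕ} (hT : Real.log T = x ^ 2) :
    expectation (clcbHistory d K T)
        (pathSum fun _ h => ind (IsGood (h.length + 1) h ∧ ¬ AllPos h)) ≤
      m * (6 / (8 * η) ^ 2 * x + 1)
        + 2 * m * Real.exp (-(2 * η ^ 2 * x)) * (m * (6 / (8 * η) ^ 2 * x ^ 2 + 1)) := by
  have hfin := finite_support_clcbHistory d K T
  have hx0 : 0 < x := by linarith
  have hc : 0 ≤ m * (6 / (8 * η) ^ 2 * x ^ 2 + 1) := by positivity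
  have hc' : 0 ≤ m * (6 / (8 * η) ^ 2 * x + 1) := by positivity
  refine le_trans ?_ (add_le_add le_rfl (mul_le_mul_of_nonneg_right
    (expectation_ind_deviates_le (d := d) (K := K) hη.le hx0 T) hc))
  rw [← expectation_mul_const, ← expectation_const hfin (m * (6 / (8 * η) ^ 2 * x + 1)),
    ← expectation_add hfin]
  refine expectation_mono hfin fun h hh => ?_
  obtain ⟨hl, hr⟩ := clcbHistory_support hh
  have hlog : ∀ h' : History d K, h'.length < h.length →
      Real.log ((h'.length + 1 : ℕ) : ℝ) ≤ x ^ 2 := fun h' hlt => by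
    rw [← hT, ← hl]
    exact log_length_le hlt
  by_cases hdev : Deviates η x h
  · rw [ind_of_true hdev, one_mul]
    have := pathSum_ind_vanish_le hη hp hm hr (sq_nonneg x) fun h' _ hlt _ => hlog h' hlt
    linarith
  · rw [ind_of_false hdev, zero_mul, add_zero]
    refine pathSum_ind_vanish_le hη hp hm hr hx0.le fun h' hs hlt hpos => ?_
    by_contra! hlate
    exact hpos (allPos_of_not_deviates hη hp hm hx3 hxη hexp (hr.of_suffix hs)
      (fun ⟨g, h1, h2⟩ => hdev ⟨g, h1.trans hs, h2⟩) (hlog h' hlt) hlate)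

theorem regret_le_vanish (hopt : IsOptimalAllocation d K kstar) (hm2 : 2 ≤ m) (hm : m < K)
    (T : ℕ) :
    regret d K kstar T ≤
      ∑ i, (((K - m + 1 : ℕ) : ℝ) ^ 2 + 12 * ((K - m + 1 : ℕ) : ℝ) ^ 2 * ((K - m : ℕ) : ℝ)
        * Real.log T * invGapMin d K kstar i)
      + gapMax d K kstar * (expectation (clcbHistory d K T)
        (pathSum fun _ h => ind (IsGood (h.length + 1) h ∧ ¬ AllPos h))
        + 3 * ((m * ((K - m + 1) / 2) : ℕ) : ℝ)) := by
  have hfin := finite_support_clcbHistory d K T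
  rw [regret_eq]
  refine le_trans ?_ (add_le_add le_rfl (mul_le_mul_of_nonneg_left
    (add_le_add le_rfl (expectation_bad_rounds_le (d := d) hm2 hm T)) gapMax_nonneg))
  rw [← expectation_add hfin, ← expectation_const_mul, ← expectation_const hfin (∑ i, _),
    ← expectation_add hfin]
  refine expectation_mono hfin fun h hh => ?_
  obtain ⟨hl, hr⟩ := clcbHistory_support hh
  refine (pathSum_gap_le (kstar := kstar) hm hr).trans ?_
  rw [mul_add, ← add_assoc]
  refine add_le_add (add_le_add ?_ ?_) le_rfl
  · have := pathSum_good_pos_le hopt hm (fun i => (invGapMin_mul_ge hopt hm2 hm i).1) hr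
    rwa [hl] at this
  · rw [← pathSum_const_mul]
    exact pathSum_mono hr fun k h' _ hk _ => mul_le_mul_of_nonneg_right
      (gap_le_gapMax hm (greedy_lowerConfidenceBound hk).1) (ind_nonneg _)

theorem sq_add_le_exp {a b x : ℝ} (hb : 0 ≤ b) (hx : 1 ≤ x)
    (h : 6 * (a + b) ≤ x) : a * x ^ 2 + b ≤ Real.exp x := by
  have h1 := Real.pow_div_factorial_le_exp x (by linarith) 3
  have h2 : ((Nat.factorial 3 : ℕ) : ℝ) = 6 := by norm_num [Nat.factorial]
  rw [h2] at h1
  have hx2 : 1 ≤ x ^ 2 := one_le_pow₀ hx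
  have h3 : b ≤ b * x ^ 2 := le_mul_of_one_le_right hb hx2
  have h4 : 6 * (a + b) * x ^ 2 ≤ x * x ^ 2 := mul_le_mul_of_nonneg_right h (by positivity)
  have h5 : x * x ^ 2 = x ^ 3 := by ring
  linarith

theorem eventually_regret_le (hopt : IsOptimalAllocation d K kstar) (hm : m < K) :
    ∀ᶠ T : ℕ in Filter.atTop, regret d K kstar T ≤
      13 * ∑ i, ((K - m + 1 : ℕ) : ℝ) ^ 3 * Real.log T * invGapMin d K kstar i := by
  rcases Nat.lt_or_ge m 2 with hm2 | hm2
  · refine Filter.Eventually.of_forall fun T => ?_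
    have : Subsingleton (Fin m) := Fin.subsingleton_iff_le_one.2 (by omega)
    refine (regret_nonpos_of_subsingleton hopt T).trans ?_
    have := Real.log_natCast_nonneg T
    exact mul_nonneg (by norm_num) (Finset.sum_nonneg fun i _ =>
      mul_nonneg (by positivity) (invGapMin_nonneg i))
  obtain ⟨i₀, hi₀⟩ := Finite.exists_min (collisionProb d)
  obtain ⟨η, hηdef⟩ : ∃ η, η = collisionProb d i₀ / 8 := ⟨_, rfl⟩
  have hη : 0 < η := by rw [hηdef]; linarith [collisionProb_pos d i₀]
  have hp : ∀ j, 8 * η ≤ collisionProb d j := fun j => by rw [hηdef]; linarith [hi₀ j]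
  set κ := ((K - m + 1 : ℕ) : ℝ) with hκ
  set S := ∑ i, κ ^ 3 * invGapMin d K kstar i with hS
  have hκ0 : 0 < κ := by rw [hκ]; positivity
  have hS0 : 0 < S := Finset.sum_pos (fun i _ =>
    mul_pos (by positivity) (invGapMin_mul_ge hopt hm2 hm i).1) Finset.univ_nonempty
  set G := gapMax d K kstar with hG
  have hG0 : 0 ≤ G := gapMax_nonneg
  set B := 3 * ((m * ((K - m + 1) / 2) : ℕ) : ℝ) with hB
  have hB0 : 0 ≤ B := by rw [hB]; positivity
  set c := 6 / (8 * η) ^ 2 with hc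
  have hc0 : 0 ≤ c := by rw [hc]; positivity
  set P := m * κ ^ 2 + G * (B + m * (c + 1) + m * (m * (c + 1)) / η ^ 2) with hP
  have hP0 : 0 ≤ P := by rw [hP]; positivity
  set X := max (max 3 (1 + 1 / η ^ 2))
    (max (P / S) (6 * (2 * m * (3 / (8 * η ^ 2)) + 2 * (m + 1)))) with hX
  have htend : Filter.Tendsto (fun T : ℕ => Real.sqrt (Real.log T)) Filter.atTop Filter.atTop :=
    Real.tendsto_sqrt_atTop.comp (Real.tendsto_log_atTop.comp tendsto_natCast_atTop_atTop)
  filter_upwards [htend.eventually_ge_atTop X] with T hT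
  obtain ⟨x, hxdef⟩ : ∃ x, x = Real.sqrt (Real.log T) := ⟨_, rfl⟩
  rw [← hxdef] at hT
  have hlog : Real.log T = x ^ 2 := by rw [hxdef, Real.sq_sqrt (Real.log_natCast_nonneg T)]
  have hx3 : 3 ≤ x := ((le_max_left _ _).trans (le_max_left _ _)).trans hT
  have hxη : 1 + 1 / η ^ 2 ≤ x := ((le_max_right _ _).trans (le_max_left _ _)).trans hT
  have hxP : P / S ≤ x := ((le_max_left _ _).trans (le_max_right _ _)).trans hT
  have hxe : 6 * (2 * m * (3 / (8 * η ^ 2)) + 2 * (m + 1)) ≤ x :=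
    ((le_max_right _ _).trans (le_max_right _ _)).trans hT
  have hx0 : 0 < x := by linarith
  have hexp : 2 * ((m : ℝ) * (3 * x ^ 2 / (8 * η ^ 2) + 1) + 1) ≤ Real.exp x := by
    refine le_trans (le_of_eq ?_) (sq_add_le_exp (by positivity) (by linarith) hxe)
    ring
  have hmain := regret_le_vanish hopt hm2 hm T
  have hvan := expectation_vanish_le hη hp hm hx3 hxη hexp hlog
  have hdecay : 2 * m * Real.exp (-(2 * η ^ 2 * x)) * (m * (c * x ^ 2 + 1))
      ≤ m * (m * (c + 1)) / η ^ 2 * x := by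
    have h1 : 2 * η ^ 2 * x * Real.exp (-(2 * η ^ 2 * x)) ≤ 1 := by
      rw [Real.exp_neg, ← div_eq_mul_inv, div_le_one (Real.exp_pos _)]
      linarith [Real.add_one_le_exp (2 * η ^ 2 * x)]
    have h2 : m * (c * x ^ 2 + 1) ≤ m * ((c + 1) * x ^ 2) := by
      refine mul_le_mul_of_nonneg_left ?_ (Nat.cast_nonneg m)
      nlinarith
    calc _ ≤ 2 * m * Real.exp (-(2 * η ^ 2 * x)) * (m * ((c + 1) * x ^ 2)) :=
          mul_le_mul_of_nonneg_left h2 (by positivity)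
      _ = m * (m * (c + 1)) / η ^ 2 * x * (2 * η ^ 2 * x * Real.exp (-(2 * η ^ 2 * x))) := by
          field_simp
      _ ≤ _ := mul_le_of_le_one_right (by positivity) h1
  have hlin : m * (c * x + 1) ≤ m * (c + 1) * x := by
    rw [mul_assoc]
    refine mul_le_mul_of_nonneg_left ?_ (Nat.cast_nonneg m)
    nlinarith
  have hBx : B ≤ B * x := le_mul_of_one_le_right hB0 (by linarith)
  have hrest : G * (expectation (clcbHistory d K T)
      (pathSum fun _ h => ind (IsGood (h.length + 1) h ∧ ¬ AllPos h)) + B)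
      ≤ G * (B + m * (c + 1) + m * (m * (c + 1)) / η ^ 2) * x := by
    rw [mul_assoc]
    refine mul_le_mul_of_nonneg_left ?_ hG0
    linarith
  have hκx : m * κ ^ 2 ≤ m * κ ^ 2 * x := le_mul_of_one_le_right (by positivity) (by linarith)
  have hPx : P * x ≤ S * x ^ 2 := by
    rw [div_le_iff₀ hS0] at hxP
    exact (mul_le_mul_of_nonneg_right hxP hx0.le).trans_eq (by ring)
  rw [Finset.sum_add_distrib, Finset.sum_const, Finset.card_univ, Fintype.card_fin,
    nsmul_eq_mul] at hmain
  have hS12 : ∑ i, 12 * κ ^ 2 * ((K - m : ℕ) : ℝ) * Real.log T * invGapMin d K kstar i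
      ≤ 12 * (S * x ^ 2) := by
    rw [hS, Finset.sum_mul, Finset.mul_sum, hlog]
    refine Finset.sum_le_sum fun i _ => ?_
    have h1 : ((K - m : ℕ) : ℝ) ≤ κ := by
      rw [hκ]
      exact_mod_cast Nat.le_succ (K - m)
    have h2 : 0 ≤ 12 * κ ^ 2 * (x ^ 2 * invGapMin d K kstar i) :=
      mul_nonneg (by positivity) (mul_nonneg (by positivity) (invGapMin_nonneg i))
    have h3 := mul_le_mul_of_nonneg_left h1 h2
    linarith
  have hgoal : 13 * ∑ i, κ ^ 3 * Real.log T * invGapMin d K kstar i = 13 * (S * x ^ 2) := by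
    rw [hS, Finset.sum_mul, hlog]
    congr 1
    exact Finset.sum_congr rfl fun i _ => by ring
  rw [hgoal]
  have hPeq : P * x = m * κ ^ 2 * x
      + G * (B + m * (c + 1) + m * (m * (c + 1)) / η ^ 2) * x := by
    rw [hP]
    ring
  linarith

end Asymptotics

end CommunityExploration

theorem theorem3 :
    ∃ C : ℝ, 0 < C ∧
      ∀ (m : ℕ) [NeZero m] (K : ℕ) (d : Fin m → ℕ+) (kstar : Fin m → ℕ),
        m < K → CommunityExploration.IsOptimalAllocation d K kstar →
          (∀ T : ℕ, 1 ≤ T →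
            CommunityExploration.regret d K kstar T ≤
              (∑ i, 48 * ((K - m + 1).choose 2 : ℝ) * (K : ℝ) * Real.log T *
                  CommunityExploration.invGapMin d K kstar i)
                + 2 * ((K - m + 1).choose 2 : ℝ) * (m : ℝ)
                + (((K - m + 1) / 2 : ℕ) : ℝ) * Real.pi ^ 2 / 3 * (m : ℝ) *
                    CommunityExploration.gapMax d K kstar) ∧
          (∀ᶠ T : ℕ in Filter.atTop,
            CommunityExploration.regret d K kstar T ≤
              C * ∑ i, ((K - m + 1 : ℕ) : ℝ) ^ 3 * Real.log T *
                  CommunityExploration.invGapMin d K kstar i) :=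
  ⟨13, by norm_num, fun _ _ _ _ _ hm hopt =>
    ⟨fun _ hT => CommunityExploration.regret_le_log hopt hm hT,
      CommunityExploration.eventually_regret_le hopt hm⟩⟩
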